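/- Let $H,K\in(0,1)$ and let $B=(B_t)_{t\in\mathbb R}$ be a two-parameter fractional Brownian motion, i.e. a continuous centered Gaussian process with covariance $$\operatorname{Cov}(B_s,B_t)=\frac1{2^K}\Big(\big(|s|^{2H}+|t|^{2H}\big)^K-|s-t|^{2HK}\Big),\qquad s,t\in\mathbb R .$$ Let $0<T_1<T_2$ and, for $t\in[0,1]$, put $Y_t=B_{(T_2-T_1)t+T_1}$. For $n\ge 1$ let $$V_n=\sum_{k=1}^{n-1}\big(Y_{(k+1)/n}+Y_{(k-1)/n}-2Y_{k/n}\big)^2,\qquad \widehat{HK}_n=\frac12-\frac{1}{2\log 2}\log\frac{V_{2n}}{V_n}.$$ Then $\widehat{HK}_n\to HK$ almost surely as $n\to\infty$, and, writing $h=HK\in(0,1)$, $$\sqrt n\,\big(\widehat{HK}_n-HK\big)\xrightarrow{(\mathcal L)}\mathcal N\!\left(0,\ \frac{3\sigma_h^2-2^{2-2h}\sigma_{*,h}^2}{8\,(4-2^{2h})^2\,(\log 2)^2}\right)$$ (in particular, the variance on the right is nonnegative), where, with $p_h=2h(2h-1)(2h-2)(2h-3)$, $a_h=2^{2h+2}-7-3^{2h}$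 and $\rho=\rho_{2-2h}$, $$\sigma_h^2=2(4-2^{2h})^2+a_h^2+p_h^2\sum_{l=2}^\infty\rho(l)^2,\qquad \sigma_{*,h}^2=3\sigma_h^2+\sigma_{1,h}^2+4\sigma_{2,h}^2,$$ $$\sigma_{1,h}^2=p_h^2\sum_{l=2}^\infty\rho(l)\rho(l-2)+\tfrac12a_h^2,\qquad \sigma_{2,h}^2=p_h^2\sum_{l=2}^\infty\rho(l)\rho(l-1)+2(4-2^{2h})a_h .$$ Here, for $\gamma\in(0,2)$ and integers $l\ge0$, $$\rho_\gamma(l)=\frac{|l-2|^{2-\gamma}-4|l-1|^{2-\gamma}+6|l|^{2-\gamma}-4|l+1|^{2-\gamma}+|l+2|^{2-\gamma}}{(\gamma-2)(\gamma-1)\gamma(\gamma+1)}\quad(\gamma\ne1),$$ and $\rho_1(l)=\frac12\big(\ell(l-2)-4\ell(l-1)+6\ell(l)-4\ell(l+1)+\ell(l+2)\big)$ with $\ell(x)=|x|\log|x|$, $\ell(0)=0$. -/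

import Mathlib

open MeasureTheory ProbabilityTheory Filter Topology

/-- The covariance function of two-parameter fractional Brownian motion,
`R(s,t) = 2^{-K} ((|s|^{2H} + |t|^{2H})^K - |s - t|^{2HK})`, for `s t : ℝ`. -/
noncomputable def twoParamFBMCov (H K s t : ℝ) : ℝ :=
  1 / 2 ^ K * ((|s| ^ (2 * H) + |t| ^ (2 * H)) ^ K - |s - t| ^ (2 * H * K))

/-- `B` is a two-parameter fractional Brownian motion with parameters `H`, `K` under `P`:
a centered Gaussian process indexed by `ℝ`, with almost surely continuous paths and covariance
function `twoParamFBMCov H K`. -/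
structure IsTwoParamFBM {Ω : Type*} [MeasurableSpace Ω] (P : Measure Ω) (H K : ℝ)
    (B : ℝ → Ω → ℝ) : Prop where
  isGaussianProcess : IsGaussianProcess B P
  continuous_paths : ∀ᵐ ω ∂P, Continuous (fun t => B t ω)
  centered : ∀ t, ∫ ω, B t ω ∂P = 0
  covariance_eq : ∀ s t, covariance (B s) (B t) P = twoParamFBMCov H K s t

/-- The process observed on `[T₁, T₂]`, reindexed by `[0, 1]`:
`Y_t = B_{τ(t)}` with `τ(t) = (T₂ - T₁) t + T₁`. -/
def reindexedProcess {Ω : Type*} (T₁ T₂ : ℝ) (B : ℝ → Ω → ℝ) : ℝ → Ω → ℝ :=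
  fun t ω => B ((T₂ - T₁) * t + T₁) ω

/-- The second-order quadratic variation of a path `x`,
`V_n(x) = ∑_{k=1}^{n-1} (x((k+1)/n) + x((k-1)/n) - 2 x(k/n))^2`.
It only involves the values of `x` on `[0, 1]`. -/
noncomputable def quadVar (n : ℕ) (x : ℝ → ℝ) : ℝ :=
  ∑ k ∈ Finset.Ico 1 n,
    (x (((k : ℝ) + 1) / n) + x (((k : ℝ) - 1) / n) - 2 * x ((k : ℝ) / n)) ^ 2

/-- The statistic `1/2 - log (V_{2n} / V_n) / (2 log 2)`. -/
noncomputable def hkEstimator (n : ℕ) (x : ℝ → ℝ) : ℝ :=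
  1 / 2 - Real.log (quadVar (2 * n) x / quadVar n x) / (2 * Real.log 2)

/-- The numbers `ρ_γ(l)`, `0 < γ < 2`, `l = 0, 1, 2, …`
(with the convention `0 log 0 = 0` when `γ = 1`). -/
noncomputable def rhoGamma (γ : ℝ) (l : ℕ) : ℝ :=
  if γ = 1 then
    1 / 2 * (|(l : ℝ) - 2| * Real.log |(l : ℝ) - 2| - 4 * (|(l : ℝ) - 1| * Real.log |(l : ℝ) - 1|)
      + 6 * (|(l : ℝ)| * Real.log |(l : ℝ)|)
      - 4 * (|(l : ℝ) + 1| * Real.log |(l : ℝ) + 1|) + |(l : ℝ) + 2| * Real.log |(l : ℝ) + 2|)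
  else
    (|(l : ℝ) - 2| ^ (2 - γ) - 4 * |(l : ℝ) - 1| ^ (2 - γ) + 6 * |(l : ℝ)| ^ (2 - γ)
      - 4 * |(l : ℝ) + 1| ^ (2 - γ) + |(l : ℝ) + 2| ^ (2 - γ))
      / ((γ - 2) * (γ - 1) * γ * (γ + 1))

/-- The factor `(2h)^2 (2h-1)^2 (2h-2)^2 (2h-3)^2`. -/
def fbmFactor (h : ℝ) : ℝ :=
  (2 * h) ^ 2 * (2 * h - 1) ^ 2 * (2 * h - 2) ^ 2 * (2 * h - 3) ^ 2

/-- `σ²_{FBM,h} = 2 (4 - 2^{2h})² + (2^{2h+2} - 7 - 3^{2h})²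
  + (2h)²(2h-1)²(2h-2)²(2h-3)² ∑_{l ≥ 2} ρ_{2-2h}(l)²`. -/
noncomputable def sigmaSqFBM (h : ℝ) : ℝ :=
  2 * (4 - (2 : ℝ) ^ (2 * h)) ^ 2 + ((2 : ℝ) ^ (2 * h + 2) - 7 - (3 : ℝ) ^ (2 * h)) ^ 2
    + fbmFactor h * ∑' l : ℕ, rhoGamma (2 - 2 * h) (l + 2) ^ 2

/-- `σ²_{1,cov,FBM,h} = (2h)²(2h-1)²(2h-2)²(2h-3)² ∑_{l ≥ 2} ρ_{2-2h}(l) ρ_{2-2h}(l-2)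
  + (2^{2h+2} - 7 - 3^{2h})² / 2`. -/
noncomputable def sigmaSqCovOneFBM (h : ℝ) : ℝ :=
  fbmFactor h * ∑' l : ℕ, rhoGamma (2 - 2 * h) (l + 2) * rhoGamma (2 - 2 * h) l
    + 1 / 2 * ((2 : ℝ) ^ (2 * h + 2) - 7 - (3 : ℝ) ^ (2 * h)) ^ 2

/-- `σ²_{2,cov,FBM,h} = (2h)²(2h-1)²(2h-2)²(2h-3)² ∑_{l ≥ 2} ρ_{2-2h}(l) ρ_{2-2h}(l-1)
  + 2 (4 - 2^{2h}) (2^{2h+2} - 7 - 3^{2h})`. -/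
noncomputable def sigmaSqCovTwoFBM (h : ℝ) : ℝ :=
  fbmFactor h * ∑' l : ℕ, rhoGamma (2 - 2 * h) (l + 2) * rhoGamma (2 - 2 * h) (l + 1)
    + 2 * (4 - (2 : ℝ) ^ (2 * h)) * ((2 : ℝ) ^ (2 * h + 2) - 7 - (3 : ℝ) ^ (2 * h))

/-- `σ²_{*,FBM,h} = 3 σ²_{FBM,h} + σ²_{1,cov,FBM,h} + 4 σ²_{2,cov,FBM,h}`. -/
noncomputable def sigmaSqStarFBM (h : ℝ) : ℝ :=
  3 * sigmaSqFBM h + sigmaSqCovOneFBM h + 4 * sigmaSqCovTwoFBM h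

/-- The asymptotic variance of the estimator, as a function of `h = HK`. -/
noncomputable def hkAsymptoticVariance (h : ℝ) : ℝ :=
  (3 * sigmaSqFBM h - (2 : ℝ) ^ (2 - 2 * h) * sigmaSqStarFBM h)
    / (8 * (4 - (2 : ℝ) ^ (2 * h)) ^ 2 * Real.log 2 ^ 2)

/-! The second differences of `B` on a grid form a Gaussian vector. Its covariance splits into two
parts. The kernel `|s - t|^{2HK}` gives exactly the stationary covariance of second order increments
of fractional Brownian motion with Hurst index `h = HK`. The kernel `(s^{2H} + t^{2H})^K` is smooth
on `[T₁, T₂]²` because `T₁ > 0`, so its double second differences are of order `n⁻⁴`. After scaling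
by `n^h`, the covariance matrix is Toeplitz with an absolutely summable symbol
(`summable_abs_fbmCov`), up to entries of order `n⁻²`. The same holds between the grids of sizes `n`
and `2n`.

A centered diagonal quadratic form of a Gaussian vector has the law of `∑ μⱼ (gⱼ² - 1)` with
independent standard Gaussian `gⱼ` (`exists_map_sum_sq_eq`). The sum of the `μⱼ²` is a weighted sum
of squared covariances, and each `|μⱼ|` is at most a maximal weighted row sum. Bounded row sums make
each weight negligible, which gives a central limit theorem through characteristic functions. They
also give exponential moments, hence eighth moments that are summable in `n`.

With `Z n` the normalized quadratic variation, the estimation error is `(log (Z n) - log (Z (2n))) /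
(2 log 2)`. The moment bound yields `√n (Z n - 1)² → 0` almost surely. This gives consistency, and
it also makes the logarithm linear up to a remainder that vanishes after scaling by `√n`. The linear
part is one quadratic form in the increments of both grids. Its limiting variance comes from Cesàro
averages of squared covariances, which `tsum_fbmCov_sq` and `tsum_fbmCrossCov_sq` identify with the
series of the statement. -/

/-! ### Diagonalization of weighted quadratic forms -/

section QuadraticForms

open scoped Matrix RealInnerProductSpace

variable {ι : Type*} [Fintype ι] [DecidableEq ι]

lemma Matrix.IsHermitian.dotProduct_mulVec_sum_eigenvectorBasis {M : Matrix ι ι ℝ}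
    (hM : M.IsHermitian) (x : ι → ℝ) :
    (∑ j, x j • hM.eigenvectorBasis j).ofLp ⬝ᵥ (M *ᵥ (∑ j, x j • hM.eigenvectorBasis j).ofLp)
      = ∑ j, hM.eigenvalues j * x j ^ 2 := by
  have h1 : Matrix.toEuclideanCLM (𝕜 := ℝ) M (∑ j, x j • hM.eigenvectorBasis j)
      = ∑ j, (hM.eigenvalues j * x j) • hM.eigenvectorBasis j := by
    rw [map_sum]
    refine Finset.sum_congr rfl fun j _ => ?_
    rw [map_smul, mul_comm, mul_smul]
    congr 1
    ext i
    simpa using congrFun (hM.mulVec_eigenvectorBasis j) i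
  rw [← Matrix.inner_toEuclideanCLM, h1, hM.eigenvectorBasis.orthonormal.inner_sum]
  refine Finset.sum_congr rfl fun j _ => ?_
  simp; ring

lemma Matrix.IsHermitian.trace_mul_self_eq_sum {M : Matrix ι ι ℝ} (hM : M.IsHermitian) :
    (M * M).trace = ∑ j, hM.eigenvalues j ^ 2 := by
  have h := hM.spectral_theorem
  rw [Unitary.conjStarAlgAut_apply] at h
  set U : Matrix ι ι ℝ := hM.eigenvectorUnitary.1
  have hU : star U * U = 1 := Unitary.coe_star_mul_self hM.eigenvectorUnitary
  set E : Matrix ι ι ℝ := Matrix.diagonal (RCLike.ofReal ∘ hM.eigenvalues) with hE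
  have h2 : M * M = U * (E * E) * star U := by
    calc M * M = (U * E * star U) * (U * E * star U) := by rw [← h]
      _ = U * E * (star U * U) * E * star U := by simp only [Matrix.mul_assoc]
      _ = U * (E * E) * star U := by rw [hU]; simp only [Matrix.mul_assoc, Matrix.one_mul]
  rw [h2, Matrix.trace_mul_cycle, hU, Matrix.one_mul, hE, Matrix.diagonal_mul_diagonal,
    Matrix.trace_diagonal]
  simp [pow_two]

/-- Diagonalization of the quadratic form `v ↦ ∑ Dᵢ (A v)ᵢ²`, with control on its eigenvalues. -/
lemma Matrix.exists_diagonalization_weighted (A : Matrix ι ι ℝ) (hA : A.IsHermitian) (D : ι → ℝ) :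
    ∃ (μ : ι → ℝ) (b : OrthonormalBasis ι ℝ (EuclideanSpace ℝ ι)),
      (∀ x : ι → ℝ, ∑ i, D i * ((A *ᵥ (∑ j, x j • b j).ofLp) i) ^ 2 = ∑ j, μ j * x j ^ 2) ∧
      ∑ j, μ j = ∑ i, D i * (A * A) i i ∧
      ∑ j, μ j ^ 2 = ∑ i, ∑ j, D i * D j * (A * A) i j ^ 2 ∧
      ∀ C : ℝ, (∀ i, ∑ j, |(A * A) i j| * |D j| ≤ C) → ∀ j, |μ j| ≤ C := by
  set M : Matrix ι ι ℝ := A * Matrix.diagonal D * A with hMdef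
  have hAT : Aᵀ = A := by simpa [Matrix.IsHermitian] using hA
  have hM : M.IsHermitian := by
    simp [hMdef, Matrix.IsHermitian, hAT, Matrix.mul_assoc]
  refine ⟨hM.eigenvalues, hM.eigenvectorBasis, fun x => ?_, ?_, ?_, fun C hC j => ?_⟩
  · rw [← hM.dotProduct_mulVec_sum_eigenvectorBasis]
    set v := (∑ j, x j • hM.eigenvectorBasis j).ofLp
    have : M *ᵥ v = A *ᵥ (Matrix.diagonal D *ᵥ (A *ᵥ v)) := by
      simp [hMdef, Matrix.mulVec_mulVec, Matrix.mul_assoc]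
    rw [this, Matrix.dotProduct_mulVec, ← Matrix.mulVec_transpose, hAT]
    simp only [dotProduct, Matrix.mulVec_diagonal]
    exact Finset.sum_congr rfl fun i _ => by ring
  · have := hM.trace_eq_sum_eigenvalues
    simp only [RCLike.ofReal_real_eq_id, id] at this
    rw [← this, hMdef, Matrix.trace_mul_cycle, Matrix.trace_mul_comm]
    simp [Matrix.trace, Matrix.diagonal_mul]
  · rw [← hM.trace_mul_self_eq_sum]
    -- Cyclicity of the trace turns `A D A A D A` into `(D A²)²`, so only the entries of `A * A`
    -- (later the covariance matrix) appear.
    have : (M * M).trace = ((Matrix.diagonal D * (A * A)) * (Matrix.diagonal D * (A * A))).trace := by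
      rw [hMdef, Matrix.mul_assoc A, Matrix.mul_assoc A, Matrix.trace_mul_comm]
      simp only [Matrix.mul_assoc]
    rw [this, Matrix.trace]
    refine Finset.sum_congr rfl fun i _ => ?_
    rw [Matrix.diag_apply, Matrix.mul_apply]
    refine Finset.sum_congr rfl fun j _ => ?_
    have hs : (A * A) j i = (A * A) i j := by
      have : (A * A)ᵀ = A * A := by rw [Matrix.transpose_mul, hAT]
      exact congrFun (congrFun this i) j
    simp only [Matrix.diagonal_mul, hs]
    ring
  · have hC0 : 0 ≤ C := le_trans (Finset.sum_nonneg fun k _ => by positivity) (hC j)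
    set lam := hM.eigenvalues j
    by_cases hlam : lam = 0
    · simpa [hlam] using hC0
    set v := (hM.eigenvectorBasis j).ofLp
    have hv : M *ᵥ v = lam • v := hM.mulVec_eigenvectorBasis j
    -- For a nonzero eigenvalue, `y = A v` is a nonzero eigenvector of `A² D` with the same
    -- eigenvalue. Reading the eigenvalue equation at a coordinate where `|y|` is maximal bounds the
    -- eigenvalue by a row sum.
    set y := A *ᵥ v with hy
    have hMv : A *ᵥ (Matrix.diagonal D *ᵥ y) = lam • v := by
      rw [← hv, hy]; simp [hMdef, Matrix.mulVec_mulVec, Matrix.mul_assoc]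
    have hyeq : (A * A) *ᵥ (Matrix.diagonal D *ᵥ y) = lam • y := by
      rw [← Matrix.mulVec_mulVec, hMv, Matrix.mulVec_smul]
    have hy0 : y ≠ 0 := by
      intro h0
      rw [h0] at hMv
      simp only [Matrix.mulVec_zero] at hMv
      have : v = 0 := (smul_eq_zero.1 hMv.symm).resolve_left hlam
      have h1 := hM.eigenvectorBasis.orthonormal.ne_zero j
      exact h1 (by ext i; exact congrFun this i)
    obtain ⟨i, hi⟩ : ∃ i, ∀ k, |y k| ≤ |y i| := by
      have : Nonempty ι := ⟨j⟩
      exact Finite.exists_max fun k => |y k|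
    have hyi : 0 < |y i| := by
      rcases Function.ne_iff.1 hy0 with ⟨k, hk⟩
      exact lt_of_lt_of_le (abs_pos.2 hk) (hi k)
    have h1 : |lam| * |y i| ≤ C * |y i| := by
      have := congrFun hyeq i
      simp only [Pi.smul_apply, smul_eq_mul] at this
      rw [← abs_mul, ← this]
      have hd : Matrix.diagonal D *ᵥ y = fun k => D k * y k :=
        funext fun k => Matrix.mulVec_diagonal D y k
      rw [hd]
      simp only [Matrix.mulVec, dotProduct]
      calc |∑ k, (A * A) i k * (D k * y k)| ≤ ∑ k, |(A * A) i k * (D k * y k)| :=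
            Finset.abs_sum_le_sum_abs _ _
        _ ≤ ∑ k, |(A * A) i k| * |D k| * |y i| := by
            refine Finset.sum_le_sum fun k _ => ?_
            rw [abs_mul, abs_mul, ← mul_assoc]
            exact mul_le_mul_of_nonneg_left (hi k) (by positivity)
        _ = (∑ k, |(A * A) i k| * |D k|) * |y i| := by rw [Finset.sum_mul]
        _ ≤ C * |y i| := mul_le_mul_of_nonneg_right (hC i) hyi.le
    exact le_of_mul_le_mul_right h1 hyi

end QuadraticForms

/-! ### Laws of quadratic forms of Gaussian vectors -/

section GaussianQuadraticForm

open scoped Matrix RealInnerProductSpace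

variable {Ω : Type*} [MeasurableSpace Ω] {P : Measure Ω} [IsProbabilityMeasure P]
  {ι : Type*} [Fintype ι]

open scoped MatrixOrder in
/-- The covariance matrix of a finite family of square integrable random variables is positive
semidefinite. -/
lemma posSemidef_covariance {X : ι → Ω → ℝ} (hX : ∀ i, MemLp (X i) 2 P) :
    (Matrix.of fun i j => cov[X i, X j; P]).PosSemidef := by
  refine Matrix.PosSemidef.of_dotProduct_mulVec_nonneg ?_ fun x => ?_
  · ext i j
    exact covariance_comm _ _
  · have h := covarianceBilin_apply_pi hX (WithLp.toLp 2 x) (WithLp.toLp 2 x)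
    have h2 := covarianceBilin_self_nonneg (μ := P.map (fun ω ↦ WithLp.toLp 2 (X · ω)))
      (WithLp.toLp 2 x)
    rw [h] at h2
    convert! h2 using 1
    simp only [star_trivial, dotProduct, Matrix.mulVec, Matrix.of_apply, Finset.mul_sum]
    exact Finset.sum_congr rfl fun i _ => Finset.sum_congr rfl fun j _ => by ring

variable [DecidableEq ι]

lemma map_toLp_eq_multivariateGaussian {X : ι → Ω → ℝ}
    (hX : HasGaussianLaw (fun ω i => X i ω) P) (h0 : ∀ i, ∫ ω, X i ω ∂P = 0) :
    P.map (fun ω => WithLp.toLp 2 (X · ω))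
      = multivariateGaussian 0 (Matrix.of fun i j => cov[X i, X j; P]) := by
  have hLp : ∀ i, MemLp (X i) 2 P := fun i => (hX.eval i).memLp_two
  have hG := hX.toLp_pi 2
  have := hG.isGaussian_map
  refine IsGaussian.ext ?_ ?_
  · rw [integral_id_multivariateGaussian', integral_map hG.aemeasurable (by fun_prop)]
    ext i
    have := (EuclideanSpace.proj i : EuclideanSpace ℝ ι →L[ℝ] ℝ).integral_comp_comm hG.integrable
    simpa [h0 i] using this.symm
  · ext x y
    rw [covarianceBilin_apply_pi hLp, covarianceBilin_multivariateGaussian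
      (posSemidef_covariance hLp)]
    simp only [dotProduct, Matrix.mulVec, Matrix.of_apply, Finset.mul_sum]
    exact Finset.sum_congr rfl fun i _ => Finset.sum_congr rfl fun j _ => by ring

/-- A centered weighted sum of squares of a Gaussian vector has the law of a weighted sum of
independent centered `χ²` variables; the weights are controlled by the covariance matrix. -/
lemma exists_map_sum_sq_eq {X : ι → Ω → ℝ}
    (hX : HasGaussianLaw (fun ω i => X i ω) P) (h0 : ∀ i, ∫ ω, X i ω ∂P = 0) (D : ι → ℝ) :
    ∃ μ : ι → ℝ,
      P.map (fun ω => ∑ i, D i * (X i ω ^ 2 - cov[X i, X i; P]))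
        = (Measure.pi fun _ : ι => gaussianReal 0 1).map (fun x => ∑ i, μ i * (x i ^ 2 - 1)) ∧
      ∑ j, μ j ^ 2 = ∑ i, ∑ j, D i * D j * cov[X i, X j; P] ^ 2 ∧
      ∀ C : ℝ, (∀ i, ∑ j, |cov[X i, X j; P]| * |D j| ≤ C) → ∀ j, |μ j| ≤ C := by
  set S : Matrix ι ι ℝ := Matrix.of fun i j => cov[X i, X j; P] with hS
  have hSpos : S.PosSemidef := posSemidef_covariance fun i => (hX.eval i).memLp_two
  -- With `A` the square root of the covariance matrix, the vector has the law of `A g`, `g`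
  -- standard Gaussian.
  open scoped MatrixOrder in
  obtain ⟨A, hA, hAA⟩ : ∃ A : Matrix ι ι ℝ, A.IsHermitian ∧ A * A = S ∧
      multivariateGaussian 0 S = (stdGaussian (EuclideanSpace ℝ ι)).map
        (fun x => Matrix.toEuclideanCLM (𝕜 := ℝ) A x) := by
    refine ⟨CFC.sqrt S, ?_, CFC.sqrt_mul_sqrt_self _ hSpos.nonneg, ?_⟩
    · exact (CFC.sqrt_nonneg S).isSelfAdjoint
    · simp [multivariateGaussian]
  obtain ⟨hAA, hmv⟩ := hAA
  obtain ⟨μ, b, hquad, hsum, hsq, hbd⟩ := A.exists_diagonalization_weighted hA D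
  rw [hAA] at hsum hsq hbd
  refine ⟨μ, ?_, hsq, hbd⟩
  have hXm : ∀ i, AEMeasurable (X i) P := fun i => (hX.eval i).aemeasurable
  set F : EuclideanSpace ℝ ι → ℝ := fun y => ∑ i, D i * (y i ^ 2 - S i i) with hF
  have hFm : Measurable F := by fun_prop
  have e1 : P.map (fun ω => ∑ i, D i * (X i ω ^ 2 - cov[X i, X i; P]))
      = (P.map (fun ω => WithLp.toLp 2 (X · ω))).map F := by
    rw [AEMeasurable.map_map_of_aemeasurable hFm.aemeasurable (hX.toLp_pi 2).aemeasurable]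
    rfl
  -- By rotation invariance `g` has independent standard coordinates in the diagonalizing basis `b`.
  -- The centering constants agree because `∑ μⱼ = ∑ Dᵢ Sᵢᵢ`.
  rw [e1, map_toLp_eq_multivariateGaussian hX h0, hmv, stdGaussian_eq_map_pi_orthonormalBasis b,
    Measure.map_map hFm (by fun_prop), Measure.map_map (by fun_prop) (by fun_prop)]
  congr 1
  ext x
  simp only [Function.comp, hF, mul_sub, Finset.sum_sub_distrib, mul_one, hsum,
    Matrix.ofLp_toEuclideanCLM, hquad]

end GaussianQuadraticForm

/-! ### Moments and exponential moments of a squared Gaussian -/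

section ChiSquare

lemma integral_pow_two_gaussianReal : ∫ x, x ^ 2 ∂(gaussianReal 0 1) = 1 := by
  have h := variance_id_gaussianReal (μ := 0) (v := 1)
  rw [variance_eq_integral (by fun_prop)] at h
  simpa [integral_id_gaussianReal] using h

lemma integral_pow_four_gaussianReal : ∫ x, x ^ 4 ∂(gaussianReal 0 1) = 3 := by
  rw [integral_gaussianReal_eq_integral_smul (by simp)]
  have h1 : ∀ x : ℝ, gaussianPDFReal 0 1 x • x ^ 4
      = (√(2 * Real.pi))⁻¹ * (fun y : ℝ => y ^ 4 * Real.exp (-(1 / 2) * y ^ 2)) |x| := by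
    intro x
    have : |x| ^ 4 = x ^ 4 := by rw [show 4 = 2 * 2 from rfl, pow_mul, pow_mul, sq_abs]
    simp only [gaussianPDFReal, smul_eq_mul, sq_abs, this]
    simp only [NNReal.coe_one, mul_one, sub_zero]
    rw [show -x ^ 2 / 2 = -(1 / 2) * x ^ 2 by ring]
    ring
  simp_rw [h1]
  rw [integral_const_mul, integral_comp_abs (f := fun y : ℝ => y ^ 4 * Real.exp (-(1 / 2) * y ^ 2))]
  have h2 := integral_rpow_mul_exp_neg_mul_rpow (p := 2) (q := 4) (b := 1 / 2) (by norm_num)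
    (by norm_num) (by norm_num)
  have h3 : Real.Gamma ((4 + 1) / 2) = 3 / 4 * √Real.pi := by
    rw [show ((4 : ℝ) + 1) / 2 = (1 / 2 + 1) + 1 by norm_num, Real.Gamma_add_one (by norm_num),
      Real.Gamma_add_one (by norm_num), Real.Gamma_one_half_eq]
    ring
  have h4 : (1 / 2 : ℝ) ^ (-(4 + 1) / 2 : ℝ) = 4 * √2 := by
    rw [one_div, Real.inv_rpow (by norm_num), ← Real.rpow_neg (by norm_num),
      show (-(-(4 + 1) / 2) : ℝ) = 2 + 1 / 2 by norm_num, Real.rpow_add (by norm_num),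
      Real.sqrt_eq_rpow]
    norm_num
  rw [h3, h4] at h2
  have h5 : ∫ x in Set.Ioi (0 : ℝ), x ^ 4 * Real.exp (-(1 / 2) * x ^ 2)
      = 4 * √2 * (1 / 2) * (3 / 4 * √Real.pi) := by
    rw [← h2]
    refine setIntegral_congr_fun measurableSet_Ioi fun x _ => ?_
    norm_cast
  rw [h5, Real.sqrt_mul (by norm_num)]
  have : √2 ≠ 0 := by positivity
  have : √Real.pi ≠ 0 := by positivity
  field_simp

lemma integrable_pow_gaussianReal (k : ℕ) : Integrable (fun x : ℝ => x ^ k) (gaussianReal 0 1) := by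
  have := (memLp_id_gaussianReal (μ := 0) (v := 1) k).integrable_norm_pow'
  refine (integrable_norm_iff (by fun_prop)).1 ?_
  simpa using this

lemma integrable_exp_mul_sq_gaussianReal {a : ℝ} (ha : a < 1 / 2) :
    Integrable (fun x : ℝ => Real.exp (a * (x ^ 2 - 1))) (gaussianReal 0 1) := by
  rw [gaussianReal_of_var_ne_zero 0 (by simp)]
  have hpdf : gaussianPDF 0 1 = fun x => ENNReal.ofReal (gaussianPDFReal 0 1 x) := rfl
  rw [hpdf, integrable_withDensity_iff_integrable_smul₀' (by fun_prop) (by simp)]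
  have h := ((integrable_exp_neg_mul_sq (b := 1 / 2 - a) (by linarith)).const_mul
    ((√(2 * Real.pi))⁻¹ * Real.exp (-a)))
  refine h.congr (Eventually.of_forall fun x => ?_)
  simp only [ENNReal.toReal_ofReal (gaussianPDFReal_nonneg 0 1 x)]
  simp only [smul_eq_mul, gaussianPDFReal,
    NNReal.coe_one, mul_one, sub_zero, mul_assoc, ← Real.exp_add]
  congr 2
  ring

lemma integral_exp_mul_sq_gaussianReal {a : ℝ} (ha : a < 1 / 2) :
    ∫ x, Real.exp (a * (x ^ 2 - 1)) ∂(gaussianReal 0 1) = Real.exp (-a) * (√(1 - 2 * a))⁻¹ := by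
  rw [integral_gaussianReal_eq_integral_smul (by simp)]
  have h1 : ∀ x : ℝ, gaussianPDFReal 0 1 x • Real.exp (a * (x ^ 2 - 1))
      = ((√(2 * Real.pi))⁻¹ * Real.exp (-a)) * Real.exp (-(1 / 2 - a) * x ^ 2) := by
    intro x
    simp only [smul_eq_mul, gaussianPDFReal, NNReal.coe_one, mul_one, sub_zero, mul_assoc,
      ← Real.exp_add]
    congr 2
    ring
  simp_rw [h1]
  rw [integral_const_mul, integral_gaussian]
  have h2 : Real.pi / (1 / 2 - a) = (2 * Real.pi) * (1 - 2 * a)⁻¹ := by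
    have : 1 - 2 * a ≠ 0 := by linarith
    have : 1 / 2 - a ≠ 0 := by linarith
    field_simp
  rw [h2, Real.sqrt_mul (x := 2 * Real.pi) (by positivity), Real.sqrt_inv]
  have : √(2 * Real.pi) ≠ 0 := by positivity
  field_simp

/-- The logarithm of the integral is `-a - log (1 - 2a) / 2`, whose linear terms cancel. For `|2a| ≤
1/2` the Taylor remainder of `log (1 - 2a)` is at most `8 a²`, and half of it remains. -/
lemma integral_exp_mul_sq_gaussianReal_le {a : ℝ} (ha : |a| ≤ 1 / 4) :
    ∫ x, Real.exp (a * (x ^ 2 - 1)) ∂(gaussianReal 0 1) ≤ Real.exp (4 * a ^ 2) := by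
  have h4 := abs_le.1 ha
  rw [integral_exp_mul_sq_gaussianReal (by linarith), ← Real.exp_log (x := (√(1 - 2 * a))⁻¹)
    (by have : 0 < 1 - 2 * a := by linarith
        positivity), ← Real.exp_add, Real.exp_le_exp, Real.log_inv, Real.log_sqrt (by linarith)]
  have hb : |2 * a| ≤ 1 / 2 := by rw [abs_mul]; norm_num; linarith
  have h := Real.abs_log_sub_add_sum_range_le (x := 2 * a) (by linarith) 1
  simp only [Finset.sum_range_one, zero_add, pow_one, Nat.cast_zero, div_one] at h
  have h2 : |2 * a| ^ 2 / (1 - |2 * a|) ≤ 8 * a ^ 2 := by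
    rw [div_le_iff₀ (by linarith), sq_abs]
    nlinarith [sq_nonneg a]
  have h3 := (abs_le.1 (h.trans h2)).1
  linarith

end ChiSquare

/-! ### Weighted sums of independent centered chi-square variables -/

section ChiSquareSums

lemma Finset.norm_prod_sub_prod_le_of_norm_le_one {ι : Type*} (s : Finset ι) (a b : ι → ℂ)
    (ha : ∀ i, ‖a i‖ ≤ 1) (hb : ∀ i, ‖b i‖ ≤ 1) :
    ‖∏ i ∈ s, a i - ∏ i ∈ s, b i‖ ≤ ∑ i ∈ s, ‖a i - b i‖ := by
  classical
  induction s using Finset.induction_on with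
  | empty => simp
  | insert i s hi ih =>
    rw [Finset.prod_insert hi, Finset.prod_insert hi, Finset.sum_insert hi]
    have hP : ‖∏ j ∈ s, a j‖ ≤ 1 := by
      rw [norm_prod]; exact Finset.prod_le_one (fun _ _ => norm_nonneg _) fun j _ => ha j
    calc ‖a i * ∏ j ∈ s, a j - b i * ∏ j ∈ s, b j‖
        = ‖(a i - b i) * ∏ j ∈ s, a j + b i * (∏ j ∈ s, a j - ∏ j ∈ s, b j)‖ := by ring_nf
      _ ≤ ‖a i - b i‖ * ‖∏ j ∈ s, a j‖ + ‖b i‖ * ‖∏ j ∈ s, a j - ∏ j ∈ s, b j‖ := by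
          refine (norm_add_le _ _).trans ?_
          rw [norm_mul, norm_mul]
      _ ≤ ‖a i - b i‖ * 1 + 1 * ∑ j ∈ s, ‖a j - b j‖ := by
          gcongr
          exact hb i
      _ = _ := by ring

/-- The normalized centered `χ²` distribution with one degree of freedom. -/
noncomputable def chiSq : Measure ℝ := (gaussianReal 0 1).map fun x => (√2)⁻¹ * (x ^ 2 - 1)

instance : IsProbabilityMeasure chiSq := Measure.isProbabilityMeasure_map (by fun_prop)

/-- Mean zero and unit variance give `chiSq` and the standard Gaussian the same second order Taylor
expansion of the characteristic function. The variance is where the fourth Gaussian moment is used.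
-/
lemma charFun_chiSq_sub_isLittleO :
    (fun t => charFun chiSq t - Complex.exp (-t ^ 2 / 2)) =o[𝓝 0] fun t : ℝ => t ^ 2 := by
  have h1 := taylor_charFun_two (P := gaussianReal 0 1) (X := fun x => (√2)⁻¹ * (x ^ 2 - 1))
    (by fun_prop) ?_ ?_
  · have h2 : (fun t : ℝ => Complex.exp (-t ^ 2 / 2) - (1 - t ^ 2 / 2)) =o[𝓝 0]
        fun t : ℝ => t ^ 2 := by
      have h3 : (fun z : ℂ => Complex.exp z - 1 - z) =o[𝓝 0] fun z : ℂ => z := by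
        have := (Complex.hasDerivAt_exp 0).isLittleO
        simpa using this
      have h4 : Tendsto (fun t : ℝ => (-t ^ 2 / 2 : ℂ)) (𝓝 0) (𝓝 0) := by
        have : Continuous (fun t : ℝ => (-t ^ 2 / 2 : ℂ)) := by fun_prop
        simpa using this.tendsto 0
      have h5 := h3.comp_tendsto h4
      refine (h5.trans_isBigO ?_).congr_left fun t => ?_
      · refine Asymptotics.IsBigO.of_bound 1 (Eventually.of_forall fun t => ?_)
        simp only [Function.comp, norm_div, norm_neg, norm_pow, Complex.norm_real]
        norm_num
        nlinarith [sq_nonneg t]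
      · simp only [Function.comp]; ring
    refine (h1.sub h2).congr_left fun t => ?_
    simp only [chiSq]; ring
  · rw [integral_const_mul, integral_sub (integrable_pow_gaussianReal 2) (by simp),
      integral_pow_two_gaussianReal]
    simp
  · have h6 : ∀ x : ℝ, ((fun x => (√2)⁻¹ * (x ^ 2 - 1)) ^ 2) x
        = 2⁻¹ * (x ^ 4 - 2 * x ^ 2 + 1) := by
      intro x
      simp only [Pi.pow_apply, mul_pow, inv_pow, Real.sq_sqrt (show (0 : ℝ) ≤ 2 by norm_num)]
      ring
    simp_rw [h6]
    rw [integral_const_mul, integral_add, integral_sub, integral_const_mul,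
      integral_pow_two_gaussianReal, integral_pow_four_gaussianReal]
    · simp; norm_num
    · exact integrable_pow_gaussianReal 4
    · exact (integrable_pow_gaussianReal 2).const_mul 2
    · exact (integrable_pow_gaussianReal 4).sub ((integrable_pow_gaussianReal 2).const_mul 2)
    · simp

lemma charFun_map_sum_sq {ι : Type*} [Fintype ι] (μ : ι → ℝ) (t : ℝ) :
    charFun ((Measure.pi fun _ : ι => gaussianReal 0 1).map
      (fun x => ∑ i, μ i * (x i ^ 2 - 1))) t = ∏ i, charFun chiSq (√2 * t * μ i) := by
  rw [charFun_apply_real, integral_map (Measurable.aemeasurable (by fun_prop)) (by fun_prop)]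
  have h : ∀ x : ι → ℝ, Complex.exp (t * ((∑ i, μ i * (x i ^ 2 - 1) : ℝ) : ℂ) * Complex.I)
      = ∏ i, (fun i (y : ℝ) => Complex.exp (t * (μ i * (y ^ 2 - 1) : ℝ) * Complex.I)) i (x i) := by
    intro x
    rw [← Complex.exp_sum]
    push_cast
    rw [Finset.mul_sum, Finset.sum_mul]
  rw [integral_congr_ae (Eventually.of_forall h), integral_fintype_prod_eq_prod
    (fun i (y : ℝ) => Complex.exp (t * (μ i * (y ^ 2 - 1) : ℝ) * Complex.I))
    (μ := fun _ => gaussianReal 0 1)]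
  refine Finset.prod_congr rfl fun i _ => ?_
  rw [charFun_apply_real, chiSq, integral_map (by fun_prop) (by fun_prop)]
  refine integral_congr_ae (Eventually.of_forall fun y => ?_)
  simp only
  congr 2
  have : (√2 : ℂ) * (√2 : ℂ)⁻¹ = 1 := by
    rw [mul_inv_cancel₀]; norm_cast; positivity
  push_cast
  linear_combination (-(t * μ i * (y ^ 2 - 1)) : ℂ) * this

/-- Lindeberg type central limit theorem for weighted sums of independent `χ²` variables. -/
lemma tendsto_charFun_map_sum_sq {ι : ℕ → Type*} [∀ n, Fintype (ι n)] (μ : ∀ n, ι n → ℝ) {v : ℝ}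
    (hsq : Tendsto (fun n => ∑ i, μ n i ^ 2) atTop (𝓝 (v / 2))) {m : ℕ → ℝ}
    (hm : Tendsto m atTop (𝓝 0)) (hμ : ∀ᶠ n in atTop, ∀ i, |μ n i| ≤ m n) (t : ℝ) :
    Tendsto (fun n => charFun ((Measure.pi fun _ : ι n => gaussianReal 0 1).map
      (fun x => ∑ i, μ n i * (x i ^ 2 - 1))) t) atTop (𝓝 (Complex.exp (-(v * t ^ 2 / 2)))) := by
  simp_rw [charFun_map_sum_sq]
  have hexp : Tendsto (fun n => ∏ i, Complex.exp (-((√2 * t * μ n i : ℝ) : ℂ) ^ 2 / 2)) atTop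
      (𝓝 (Complex.exp (-(v * t ^ 2 / 2)))) := by
    have h1 : ∀ n, ∏ i, Complex.exp (-((√2 * t * μ n i : ℝ) : ℂ) ^ 2 / 2)
        = Complex.exp ((-(t ^ 2 * ∑ i, μ n i ^ 2) : ℝ) : ℂ) := by
      intro n
      rw [← Complex.exp_sum]
      congr 1
      push_cast
      rw [Finset.mul_sum, ← Finset.sum_neg_distrib]
      refine Finset.sum_congr rfl fun i _ => ?_
      have : (√2 : ℂ) ^ 2 = 2 := by
        norm_cast; rw [Real.sq_sqrt (by norm_num)]
      linear_combination (-(t ^ 2 * μ n i ^ 2) / 2 : ℂ) * this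
    simp_rw [h1]
    have h2 : Tendsto (fun n => -(t ^ 2 * ∑ i, μ n i ^ 2)) atTop (𝓝 (-(v * t ^ 2 / 2))) := by
      have := (hsq.const_mul (t ^ 2)).neg
      convert! this using 2; ring
    have h3 := (Complex.continuous_exp.comp Complex.continuous_ofReal).tendsto
      (-(v * t ^ 2 / 2)) |>.comp h2
    convert! h3 using 2
    simp
  have hdiff : Tendsto (fun n => ∏ i, charFun chiSq (√2 * t * μ n i)
      - ∏ i, Complex.exp (-((√2 * t * μ n i : ℝ) : ℂ) ^ 2 / 2)) atTop (𝓝 0) := by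
    rw [Metric.tendsto_nhds]
    intro ε hε
    set V := |v / 2| + 1 with hV
    have hVpos : 0 < V := by positivity
    -- The two products are compared factor by factor. All arguments `√2 t μᵢ` are eventually
    -- uniformly small, so the errors add up to at most `η * 2 t² ∑ μᵢ²`, which this `η` keeps below
    -- `ε`. The `+ 1` covers `t = 0`.
    set η := ε / (2 * (2 * t ^ 2 * V + 1)) with hη
    have hηpos : 0 < η := by positivity
    have ho := charFun_chiSq_sub_isLittleO.bound hηpos
    rw [Metric.eventually_nhds_iff] at ho
    obtain ⟨δ, hδ, ho⟩ := ho
    have hm' : Tendsto (fun n => |√2 * t| * m n) atTop (𝓝 0) := by simpa using hm.const_mul |√2 * t|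
    filter_upwards [hm'.eventually_lt_const hδ, hμ,
      hsq.eventually_lt_const (show v / 2 < V by rw [hV]; linarith [le_abs_self (v / 2)])]
      with n hn1 hn2 hn3
    rw [dist_zero_right]
    refine (Finset.norm_prod_sub_prod_le_of_norm_le_one _ _ _
      (fun i => norm_charFun_le_one _) (fun i => ?_)).trans_lt ?_
    · rw [Complex.norm_exp, Real.exp_le_one_iff]
      have : (-((√2 * t * μ n i : ℝ) : ℂ) ^ 2 / 2) = ((-(√2 * t * μ n i) ^ 2 / 2 : ℝ) : ℂ) := by
        push_cast; ring
      rw [this, Complex.ofReal_re]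
      nlinarith [sq_nonneg (√2 * t * μ n i)]
    · have hb : ∀ i, ‖charFun chiSq (√2 * t * μ n i)
          - Complex.exp (-((√2 * t * μ n i : ℝ) : ℂ) ^ 2 / 2)‖ ≤ η * (2 * t ^ 2 * μ n i ^ 2) := by
        intro i
        have := ho (y := √2 * t * μ n i) (by
          rw [Real.dist_eq, sub_zero, abs_mul]
          exact (mul_le_mul_of_nonneg_left (hn2 i) (abs_nonneg _)).trans_lt hn1)
        refine this.trans_eq ?_
        rw [Real.norm_eq_abs, abs_of_nonneg (sq_nonneg _), mul_pow, mul_pow,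
          Real.sq_sqrt (by norm_num)]
      refine (Finset.sum_le_sum fun i _ => hb i).trans_lt ?_
      rw [← Finset.mul_sum, ← Finset.mul_sum]
      calc η * (2 * t ^ 2 * ∑ i, μ n i ^ 2) ≤ η * (2 * t ^ 2 * V + 1) := by
            gcongr; nlinarith [sq_nonneg t]
        _ = ε / 2 := by rw [hη]; field_simp
        _ < ε := by linarith
  simpa using hdiff.add hexp

lemma integral_exp_sum_sq_le {ι : Type*} [Fintype ι] (μ : ι → ℝ) {θ : ℝ}
    (hμ : ∀ i, |θ * μ i| ≤ 1 / 4) :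
    Integrable (fun x : ι → ℝ => Real.exp (θ * ∑ i, μ i * (x i ^ 2 - 1)))
      (Measure.pi fun _ : ι => gaussianReal 0 1) ∧
    ∫ x, Real.exp (θ * ∑ i, μ i * (x i ^ 2 - 1)) ∂(Measure.pi fun _ : ι => gaussianReal 0 1)
      ≤ Real.exp (4 * θ ^ 2 * ∑ i, μ i ^ 2) := by
  have h : ∀ x : ι → ℝ, Real.exp (θ * ∑ i, μ i * (x i ^ 2 - 1))
      = ∏ i, (fun i (y : ℝ) => Real.exp ((θ * μ i) * (y ^ 2 - 1))) i (x i) := by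
    intro x
    rw [← Real.exp_sum, Finset.mul_sum]
    simp only [mul_assoc]
  have hlt : ∀ i, θ * μ i < 1 / 2 := fun i => by linarith [le_abs_self (θ * μ i), hμ i]
  rw [integral_congr_ae (Eventually.of_forall h), funext h]
  constructor
  · exact Integrable.fintype_prod fun i => integrable_exp_mul_sq_gaussianReal (hlt i)
  · rw [integral_fintype_prod_eq_prod (fun i (y : ℝ) => Real.exp ((θ * μ i) * (y ^ 2 - 1)))
      (μ := fun _ => gaussianReal 0 1), Finset.mul_sum, Real.exp_sum]
    refine Finset.prod_le_prod (fun i _ => integral_nonneg fun _ => (Real.exp_pos _).le)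
      fun i _ => ?_
    refine (integral_exp_mul_sq_gaussianReal_le (hμ i)).trans_eq ?_
    congr 1; ring

/-- From `y⁸ / 8! ≤ exp |y| ≤ exp y + exp (-y)`, with `8! = 40320`, the eighth moment is controlled
by the exponential moments at `θ` and `-θ`. -/
lemma lintegral_pow_eight_sum_sq_le {ι : Type*} [Fintype ι] (μ : ι → ℝ) {θ : ℝ}
    (hμ : ∀ i, |θ * μ i| ≤ 1 / 4) :
    ∫⁻ x, ENNReal.ofReal ((θ * ∑ i, μ i * (x i ^ 2 - 1)) ^ 8)
        ∂(Measure.pi fun _ : ι => gaussianReal 0 1)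
      ≤ ENNReal.ofReal (2 * 40320 * Real.exp (4 * θ ^ 2 * ∑ i, μ i ^ 2)) := by
  obtain ⟨hi, hle⟩ := integral_exp_sum_sq_le μ hμ
  obtain ⟨hi', hle'⟩ := integral_exp_sum_sq_le μ (θ := -θ) (by simpa using hμ)
  rw [neg_sq] at hle'
  have hpt : ∀ y : ℝ, y ^ 8 ≤ 40320 * (Real.exp y + Real.exp (-y)) := by
    intro y
    have h1 := Real.pow_div_factorial_le_exp |y| (abs_nonneg y) 8
    rw [show ((8 : ℕ).factorial : ℝ) = 40320 by norm_num [Nat.factorial], div_le_iff₀ (by norm_num)]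
      at h1
    have h2 : |y| ^ 8 = y ^ 8 := (show Even 8 by decide).pow_abs y
    rw [h2] at h1
    have h3 : Real.exp |y| ≤ Real.exp y + Real.exp (-y) := by
      rcases abs_cases y with h | h <;> rw [h.1] <;> linarith [Real.exp_pos y, Real.exp_pos (-y)]
    linarith
  calc _ ≤ ∫⁻ x, ENNReal.ofReal (40320 * (Real.exp (θ * ∑ i, μ i * (x i ^ 2 - 1))
          + Real.exp (-θ * ∑ i, μ i * (x i ^ 2 - 1)))) ∂(Measure.pi fun _ : ι => gaussianReal 0 1) :=
        lintegral_mono fun x => ENNReal.ofReal_le_ofReal (by simpa using hpt _)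
    _ = ENNReal.ofReal (∫ x, 40320 * (Real.exp (θ * ∑ i, μ i * (x i ^ 2 - 1))
          + Real.exp (-θ * ∑ i, μ i * (x i ^ 2 - 1))) ∂(Measure.pi fun _ : ι => gaussianReal 0 1)) :=
        (ofReal_integral_eq_lintegral_ofReal ((hi.add hi').const_mul _)
          (Eventually.of_forall fun x =>
            mul_nonneg (by norm_num) (add_nonneg (Real.exp_pos _).le (Real.exp_pos _).le))).symm
    _ ≤ _ := by
        refine ENNReal.ofReal_le_ofReal ?_
        rw [integral_const_mul, integral_add hi hi']
        linarith

end ChiSquareSums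

/-! ### Limit theorems for quadratic forms of Gaussian vectors -/

section GaussianQuadraticSequences

variable {Ω : Type*} [MeasurableSpace Ω] {P : Measure Ω} [IsProbabilityMeasure P]

/-- Central limit theorem for centered diagonal quadratic forms of Gaussian vectors. -/
lemma tendstoInDistribution_gaussian_sum_sq {ι : ℕ → Type*} [∀ n, Fintype (ι n)]
    {X : ∀ n, ι n → Ω → ℝ} (hX : ∀ n, HasGaussianLaw (fun ω i => X n i ω) P)
    (h0 : ∀ n i, ∫ ω, X n i ω ∂P = 0) (D : ∀ n, ι n → ℝ) {v : ℝ} (hv : 0 ≤ v)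
    (hvar : Tendsto (fun n => ∑ i, ∑ j, D n i * D n j * cov[X n i, X n j; P] ^ 2) atTop
      (𝓝 (v / 2))) {m : ℕ → ℝ} (hm : Tendsto m atTop (𝓝 0))
    (hrow : ∀ᶠ n in atTop, ∀ i, ∑ j, |cov[X n i, X n j; P]| * |D n j| ≤ m n) :
    TendstoInDistribution (fun n ω => ∑ i, D n i * (X n i ω ^ 2 - cov[X n i, X n i; P])) atTop
      (id : ℝ → ℝ) (fun _ => P) (gaussianReal 0 v.toNNReal) where
  forall_aemeasurable n := by
    have := fun i => ((hX n).eval i).aemeasurable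
    fun_prop
  tendsto := by
    classical
    choose μ hmap hsq hbd using fun n => exists_map_sum_sq_eq (hX n) (h0 n) (D n)
    refine ProbabilityMeasure.tendsto_iff_tendsto_charFun.2 fun t => ?_
    have key := tendsto_charFun_map_sum_sq μ (v := v) (m := m) (by simpa only [hsq] using hvar) hm
      (hrow.mono fun n hn => hbd n _ hn) t
    simp only [ProbabilityMeasure.coe_mk, hmap, Measure.map_id, charFun_gaussianReal]
    convert! key using 2
    simp [hv]

/-- Almost sure convergence to zero, with a rate, of centered diagonal quadratic forms of
Gaussian vectors. -/
lemma ae_tendsto_sqrt_mul_gaussian_sum_sq {ι : ℕ → Type*} [∀ n, Fintype (ι n)]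
    {X : ∀ n, ι n → Ω → ℝ} (hX : ∀ n, HasGaussianLaw (fun ω i => X n i ω) P)
    (h0 : ∀ n i, ∫ ω, X n i ω ∂P = 0) (D : ∀ n, ι n → ℝ) {C : ℝ}
    (hvar : ∀ᶠ n : ℕ in atTop, ∑ i, ∑ j, D n i * D n j * cov[X n i, X n j; P] ^ 2 ≤ C / n)
    (hrow : ∀ᶠ n : ℕ in atTop, ∀ i, ∑ j, |cov[X n i, X n j; P]| * |D n j| ≤ C / n) :
    ∀ᵐ ω ∂P, Tendsto
      (fun n : ℕ => √(n : ℝ) * (∑ i, D n i * (X n i ω ^ 2 - cov[X n i, X n i; P])) ^ 2)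
      atTop (𝓝 0) := by
  classical
  set Q : ℕ → Ω → ℝ := fun n ω => ∑ i, D n i * (X n i ω ^ 2 - cov[X n i, X n i; P]) with hQ
  have hQm : ∀ n, AEMeasurable (Q n) P := fun n => by
    have := fun i => ((hX n).eval i).aemeasurable
    fun_prop
  have hsqrt : Tendsto (fun n : ℕ => √(n : ℝ)) atTop atTop :=
    Real.tendsto_sqrt_atTop.comp tendsto_natCast_atTop_atTop
  -- The exponential bound is applied with `θ = √n`. The weights are at most `C / n`, so `|θ μᵢ| ≤
  -- 1/4` once `√n ≥ 4C`, and `θ² ∑ μᵢ² ≤ C`. Thus `√n Q` has bounded eighth moment, and `n² Q⁸ =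
  -- n⁻² (√n Q)⁸` has summable expectation.
  have hbound : ∀ᶠ n : ℕ in atTop, ∫⁻ ω, ENNReal.ofReal ((n : ℝ) ^ 2 * Q n ω ^ 8) ∂P
      ≤ ENNReal.ofReal (2 * 40320 * Real.exp (4 * C) * (1 / (n : ℝ) ^ 2)) := by
    filter_upwards [hvar, hrow, hsqrt.eventually_ge_atTop (4 * C), eventually_gt_atTop 0]
      with n hn1 hn2 hn3 hn4
    have hn : (0 : ℝ) < n := by exact_mod_cast hn4
    obtain ⟨μ, hmap, hsq, hbd⟩ := exists_map_sum_sq_eq (hX n) (h0 n) (D n)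
    have hμ : ∀ i, |√(n : ℝ) * μ i| ≤ 1 / 4 := by
      intro i
      rw [abs_mul, abs_of_nonneg (Real.sqrt_nonneg _)]
      have h1 := hbd _ hn2 i
      have h2 : √(n : ℝ) * √(n : ℝ) = n := Real.mul_self_sqrt hn.le
      have h3 : 0 < √(n : ℝ) := Real.sqrt_pos.2 hn
      calc √(n : ℝ) * |μ i| ≤ √(n : ℝ) * (C / n) := by gcongr
        _ = C / √(n : ℝ) := by
            field_simp
            rw [pow_two, h2, mul_comm]
        _ ≤ 1 / 4 := by rw [div_le_iff₀ h3]; linarith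
    have hθ := lintegral_pow_eight_sum_sq_le μ hμ
    have hfm : Measurable fun y : ℝ => ENNReal.ofReal ((√(n : ℝ) * y) ^ 8) := by fun_prop
    have e1 : ∫⁻ ω, ENNReal.ofReal ((√(n : ℝ) * Q n ω) ^ 8) ∂P
        = ∫⁻ x, ENNReal.ofReal ((√(n : ℝ) * ∑ i, μ i * (x i ^ 2 - 1)) ^ 8)
          ∂(Measure.pi fun _ => gaussianReal 0 1) := by
      rw [← lintegral_map' hfm.aemeasurable (hQm n), hQ, hmap, lintegral_map hfm (by fun_prop)]
    rw [← e1] at hθ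
    have e2 : ∀ ω, ENNReal.ofReal ((n : ℝ) ^ 2 * Q n ω ^ 8)
        = ENNReal.ofReal (1 / (n : ℝ) ^ 2) * ENNReal.ofReal ((√(n : ℝ) * Q n ω) ^ 8) := by
      intro ω
      rw [← ENNReal.ofReal_mul (by positivity), mul_pow,
        show √(n : ℝ) ^ 8 = (√(n : ℝ) ^ 2) ^ 4 by ring, Real.sq_sqrt hn.le]
      congr 1
      field_simp
    simp_rw [e2]
    rw [lintegral_const_mul' _ _ ENNReal.ofReal_ne_top, mul_comm,
      ENNReal.ofReal_mul (by positivity)]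
    refine mul_le_mul_left (hθ.trans (ENNReal.ofReal_le_ofReal ?_)) _
    gcongr _ * Real.exp ?_
    rw [Real.sq_sqrt hn.le, hsq, mul_assoc]
    have := mul_le_mul_of_nonneg_left hn1 hn.le
    rw [mul_div_cancel₀ _ hn.ne'] at this
    linarith
  obtain ⟨N, hN⟩ := eventually_atTop.1 hbound
  have hsum : Summable fun n : ℕ => 2 * 40320 * Real.exp (4 * C) * (1 / ((n + N : ℕ) : ℝ) ^ 2) :=
    ((summable_nat_add_iff N).2 (Real.summable_one_div_nat_pow.2 one_lt_two)).mul_left _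
  -- Finiteness of the expected series makes it converge almost surely, so its terms tend to zero.
  -- No relation between different `n` is needed.
  have hfin : ∫⁻ ω, ∑' n : ℕ, ENNReal.ofReal (((n + N : ℕ) : ℝ) ^ 2 * Q (n + N) ω ^ 8) ∂P ≠ ⊤ := by
    rw [lintegral_tsum]
    · refine ne_top_of_le_ne_top ?_ (ENNReal.tsum_le_tsum fun n => hN (n + N) (by omega))
      rw [← ENNReal.ofReal_tsum_of_nonneg (fun n => by positivity) hsum]
      exact ENNReal.ofReal_ne_top
    · intro n
      have := hQm (n + N)
      fun_prop
  have hae := ae_lt_top' (by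
    have := fun n => hQm (n + N)
    fun_prop) hfin
  filter_upwards [hae] with ω hω
  have h1 := ENNReal.tendsto_atTop_zero_of_tsum_ne_top hω.ne
  have h2 : Tendsto (fun n : ℕ => ((n + N : ℕ) : ℝ) ^ 2 * Q (n + N) ω ^ 8) atTop (𝓝 0) := by
    have := (ENNReal.tendsto_toReal ENNReal.zero_ne_top).comp h1
    refine this.congr fun n => ?_
    simp only [Function.comp]
    rw [ENNReal.toReal_ofReal]
    have : 0 ≤ Q (n + N) ω ^ 8 := (show Even 8 by decide).pow_nonneg _
    positivity
  have h3 := (tendsto_add_atTop_iff_nat (f := fun n : ℕ => (n : ℝ) ^ 2 * Q n ω ^ 8) N).1 h2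
  -- The fourth root of `n² Q⁸` is `√n Q²`.
  have h4 := (Real.continuous_sqrt.tendsto _).comp ((Real.continuous_sqrt.tendsto _).comp h3)
  simp only [Real.sqrt_zero] at h4
  refine h4.congr fun n => ?_
  simp only [Function.comp]
  have e : (n : ℝ) ^ 2 * Q n ω ^ 8 = ((√(n : ℝ) * Q n ω ^ 2) ^ 2) ^ 2 := by
    rw [mul_pow, Real.sq_sqrt (by positivity)]; ring
  rw [e, Real.sqrt_sq (by positivity), Real.sqrt_sq (by positivity)]

end GaussianQuadraticSequences

/-! ### Second differences and second derivatives -/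

section SecondDifferences

/-- The symmetric second difference of `f` at `x` with step `δ`. -/
def secondDiff (f : ℝ → ℝ) (x δ : ℝ) : ℝ := f (x + δ) + f (x - δ) - 2 * f x

/-- The mean value inequality is used twice: on `f'`, then on `u ↦ f (x + u) + f (x - u)`, whose
derivative is `f' (x + u) - f' (x - u)`. The factor 2 is not optimal. -/
lemma abs_secondDiff_le {f f' f'' : ℝ → ℝ} {x δ M : ℝ} (hδ : 0 ≤ δ)
    (hf : ∀ y ∈ Set.Icc (x - δ) (x + δ), HasDerivAt f (f' y) y)
    (hf' : ∀ y ∈ Set.Icc (x - δ) (x + δ), HasDerivAt f' (f'' y) y)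
    (hM : ∀ y ∈ Set.Icc (x - δ) (x + δ), |f'' y| ≤ M) :
    |secondDiff f x δ| ≤ 2 * M * δ ^ 2 := by
  have hM0 : 0 ≤ M := (abs_nonneg _).trans (hM x ⟨by linarith, by linarith⟩)
  have h1 : ∀ u ∈ Set.Icc 0 δ, |f' (x + u) - f' (x - u)| ≤ 2 * M * δ := by
    intro u hu
    have := (convex_Icc (x - δ) (x + δ)).norm_image_sub_le_of_norm_hasDerivWithin_le
      (f := f') (f' := f'') (C := M) (fun y hy => (hf' y hy).hasDerivWithinAt)
      (fun y hy => by simpa using hM y hy)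
      (x := x - u) (y := x + u) ⟨by linarith [hu.2], by linarith [hu.1]⟩
      ⟨by linarith [hu.1], by linarith [hu.2]⟩
    rw [Real.norm_eq_abs, Real.norm_eq_abs, show x + u - (x - u) = 2 * u by ring,
      abs_of_nonneg (by linarith [hu.1] : 0 ≤ 2 * u)] at this
    nlinarith [hu.2]
  have h2 : ∀ u ∈ Set.Icc 0 δ, HasDerivAt (fun u => f (x + u) + f (x - u))
      (f' (x + u) - f' (x - u)) u := by
    intro u hu
    have ha := (hf (x + u) ⟨by linarith [hu.1], by linarith [hu.2]⟩).comp_const_add x u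
    have hb := (hf (x - u) ⟨by linarith [hu.2], by linarith [hu.1]⟩).comp_const_sub x u
    exact (ha.add hb).congr_deriv (by ring)
  have h3 := (convex_Icc 0 δ).norm_image_sub_le_of_norm_hasDerivWithin_le
      (C := 2 * M * δ) (fun y hy => (h2 y hy).hasDerivWithinAt)
      (fun y hy => by simpa using h1 y hy) (x := 0) (y := δ) ⟨le_rfl, hδ⟩ ⟨hδ, le_rfl⟩
  simp only [add_zero, sub_zero, Real.norm_eq_abs, abs_of_nonneg hδ] at h3
  rw [secondDiff, show f (x + δ) + f (x - δ) - 2 * f x = f (x + δ) + f (x - δ) - (f x + f x) by ring]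
  linarith

lemma HasDerivAt.secondDiff_right {F F' : ℝ → ℝ → ℝ} {x t ε : ℝ}
    (h : ∀ y ∈ Set.Icc (t - |ε|) (t + |ε|), HasDerivAt (fun x => F x y) (F' x y) x) :
    HasDerivAt (fun x => secondDiff (F x) t ε) (secondDiff (F' x) t ε) x := by
  have h1 := abs_le.1 (le_refl |ε|)
  have h0 := abs_nonneg ε
  exact ((h (t + ε) ⟨by linarith, by linarith⟩).add (h (t - ε) ⟨by linarith, by linarith⟩)).sub
    ((h t ⟨by linarith, by linarith⟩).const_mul 2)

lemma secondDiff_const_mul (c : ℝ) (f : ℝ → ℝ) (x δ : ℝ) :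
    secondDiff (fun y => c * f y) x δ = c * secondDiff f x δ := by
  simp only [secondDiff]; ring

lemma secondDiff_add (f g : ℝ → ℝ) (x δ : ℝ) :
    secondDiff (fun y => f y + g y) x δ = secondDiff f x δ + secondDiff g x δ := by
  simp only [secondDiff]; ring

end SecondDifferences

/-! ### The smooth part of the covariance -/

section SumOfPowers

lemma hasDerivAt_rpow_add_rpow (a p : ℝ) {x w : ℝ} (hx : 0 < x) (hw : 0 < w) :
    HasDerivAt (fun x => (x ^ a + w) ^ p) (p * (x ^ a + w) ^ (p - 1) * (a * x ^ (a - 1))) x := by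
  have h1 : HasDerivAt (fun x : ℝ => x ^ a + w) (a * x ^ (a - 1)) x :=
    (Real.hasDerivAt_rpow_const (Or.inl hx.ne')).add_const w
  have h2 := h1.rpow_const (p := p) (Or.inl (by positivity))
  convert! h2 using 1
  ring

lemma hasDerivAt_rpow_add_rpow_deriv (a p : ℝ) {x w : ℝ} (hx : 0 < x) (hw : 0 < w) :
    HasDerivAt (fun x => p * (x ^ a + w) ^ (p - 1) * (a * x ^ (a - 1)))
      (p * (p - 1) * (a * x ^ (a - 1)) ^ 2 * (x ^ a + w) ^ (p - 2)
        + p * (a * (a - 1) * x ^ (a - 2)) * (x ^ a + w) ^ (p - 1)) x := by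
  have h1 := (hasDerivAt_rpow_add_rpow a (p - 1) hx hw).const_mul p
  have h2 := (Real.hasDerivAt_rpow_const (x := x) (p := a - 1) (Or.inl hx.ne')).const_mul a
  have h3 := h1.mul h2
  convert! h3 using 1
  rw [show p - 1 - 1 = p - 2 by ring, show a - 1 - 1 = a - 2 by ring]
  ring

/-- The second derivative is jointly continuous on the compact square `[T₁, T₂]²`, which avoids the
origin; hence a bound uniform in `s`. -/
lemma exists_abs_secondDiff_rpow_add_rpow_le (a p : ℝ) {T₁ T₂ : ℝ} (hT₁ : 0 < T₁) :
    ∃ C, 0 ≤ C ∧ ∀ s ∈ Set.Icc T₁ T₂, ∀ t ε, 0 ≤ ε → T₁ ≤ t - ε → t + ε ≤ T₂ →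
      |secondDiff (fun y => (s ^ a + y ^ a) ^ p) t ε| ≤ C * ε ^ 2 := by
  set g : ℝ × ℝ → ℝ := fun z => p * (p - 1) * (a * z.2 ^ (a - 1)) ^ 2 * (z.2 ^ a + z.1 ^ a) ^ (p - 2)
        + p * (a * (a - 1) * z.2 ^ (a - 2)) * (z.2 ^ a + z.1 ^ a) ^ (p - 1)
  have hg : ContinuousOn g (Set.Icc T₁ T₂ ×ˢ Set.Icc T₁ T₂) := by
    intro z hz
    have h1 : 0 < z.1 := hT₁.trans_le hz.1.1
    have h2 : 0 < z.2 := hT₁.trans_le hz.2.1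
    have h3 : z.2 ^ a + z.1 ^ a ≠ 0 := by positivity
    have := h1.ne'
    have := h2.ne'
    refine ContinuousAt.continuousWithinAt ?_
    have c1 : ∀ b : ℝ, ContinuousAt (fun z : ℝ × ℝ => z.1 ^ b) z := fun b =>
      continuousAt_fst.rpow_const (Or.inl h1.ne')
    have c2 : ∀ b : ℝ, ContinuousAt (fun z : ℝ × ℝ => z.2 ^ b) z := fun b =>
      continuousAt_snd.rpow_const (Or.inl h2.ne')
    have c3 : ∀ b : ℝ, ContinuousAt (fun z : ℝ × ℝ => (z.2 ^ a + z.1 ^ a) ^ b) z := fun b =>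
      ((c2 a).add (c1 a)).rpow_const (Or.inl h3)
    exact (((continuousAt_const.mul ((continuousAt_const.mul (c2 _)).pow 2)).mul (c3 _))).add
      ((continuousAt_const.mul (continuousAt_const.mul (c2 _))).mul (c3 _))
  obtain ⟨M, hM⟩ := (isCompact_Icc.prod isCompact_Icc).exists_bound_of_continuousOn hg
  refine ⟨2 * max M 0, by positivity, fun s hs t ε hε h1 h2 => ?_⟩
  have hs0 : 0 < s := hT₁.trans_le hs.1
  have hsub : ∀ y ∈ Set.Icc (t - ε) (t + ε), 0 < y ∧ y ∈ Set.Icc T₁ T₂ := fun y hy =>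
    ⟨by linarith [hy.1], by linarith [hy.1], by linarith [hy.2]⟩
  have hcomm : (fun y : ℝ => (s ^ a + y ^ a) ^ p) = fun y => (y ^ a + s ^ a) ^ p := by
    ext y; rw [add_comm]
  rw [hcomm]
  refine abs_secondDiff_le hε
    (fun y hy => hasDerivAt_rpow_add_rpow a p (hsub y hy).1 (by positivity))
    (fun y hy => hasDerivAt_rpow_add_rpow_deriv a p (hsub y hy).1 (by positivity))
    (fun y hy => ?_)
  exact (hM (s, y) ⟨hs, (hsub y hy).2⟩).trans (le_max_left _ _)

/-- Two derivatives in `x` commute with the second difference in `y`. They produce `(x^a +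
y^a)^(p-1)` and `(x^a + y^a)^(p-2)` with coefficients depending on `x` alone, so the one-variable
bound applies to each term. -/
lemma exists_abs_secondDiff_secondDiff_le (a p : ℝ) {T₁ T₂ : ℝ} (hT₁ : 0 < T₁) :
    ∃ C, 0 ≤ C ∧ ∀ s δ t ε, 0 ≤ δ → T₁ ≤ s - δ → s + δ ≤ T₂ → 0 ≤ ε → T₁ ≤ t - ε → t + ε ≤ T₂ →
      |secondDiff (fun x => secondDiff (fun y => (x ^ a + y ^ a) ^ p) t ε) s δ|
        ≤ C * δ ^ 2 * ε ^ 2 := by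
  obtain ⟨C₁, hC₁, h₁⟩ := exists_abs_secondDiff_rpow_add_rpow_le a (p - 1) (T₂ := T₂) hT₁
  obtain ⟨C₂, hC₂, h₂⟩ := exists_abs_secondDiff_rpow_add_rpow_le a (p - 2) (T₂ := T₂) hT₁
  have hbdd : ∀ (c b : ℝ) (k : ℕ), ∃ M, 0 ≤ M ∧ ∀ x ∈ Set.Icc T₁ T₂, |c * (x ^ b) ^ k| ≤ M := by
    intro c b k
    have : ContinuousOn (fun x : ℝ => c * (x ^ b) ^ k) (Set.Icc T₁ T₂) := fun x hx =>
      (continuousAt_const.mul ((Real.continuousAt_rpow_const x b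
        (Or.inl (hT₁.trans_le hx.1).ne')).pow k)).continuousWithinAt
    obtain ⟨M, hM⟩ := isCompact_Icc.exists_bound_of_continuousOn this
    exact ⟨max M 0, le_max_right _ _, fun x hx => (hM x hx).trans (le_max_left _ _)⟩
  obtain ⟨M₁, hM₁, hb₁⟩ := hbdd (p * (a * (a - 1))) (a - 2) 1
  obtain ⟨M₂, hM₂, hb₂⟩ := hbdd (p * (p - 1) * a ^ 2) (a - 1) 2
  refine ⟨2 * (M₂ * C₂ + M₁ * C₁), by positivity, fun s δ t ε hδ hs1 hs2 hε ht1 ht2 => ?_⟩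
  have hx : ∀ x ∈ Set.Icc (s - δ) (s + δ), 0 < x ∧ x ∈ Set.Icc T₁ T₂ := fun y hy =>
    ⟨by linarith [hy.1], by linarith [hy.1], by linarith [hy.2]⟩
  have hy : ∀ y ∈ Set.Icc (t - |ε|) (t + |ε|), 0 < y := by
    intro y hy
    rw [abs_of_nonneg hε] at hy
    linarith [hy.1]
  have key := abs_secondDiff_le (M := (M₂ * C₂ + M₁ * C₁) * ε ^ 2) hδ
    (fun x hx' => HasDerivAt.secondDiff_right (t := t) (ε := ε)
      (F := fun x y => (x ^ a + y ^ a) ^ p) fun y hy' =>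
        hasDerivAt_rpow_add_rpow a p (hx x hx').1 (Real.rpow_pos_of_pos (hy y hy') a))
    (fun x hx' => HasDerivAt.secondDiff_right (t := t) (ε := ε)
      (F' := fun x y => p * (p - 1) * (a * x ^ (a - 1)) ^ 2 * (x ^ a + y ^ a) ^ (p - 2)
        + p * (a * (a - 1) * x ^ (a - 2)) * (x ^ a + y ^ a) ^ (p - 1)) fun y hy' =>
        hasDerivAt_rpow_add_rpow_deriv a p (hx x hx').1 (Real.rpow_pos_of_pos (hy y hy') a))
    (fun x hx' => ?_)
  · linarith
  · rw [secondDiff_add, secondDiff_const_mul, secondDiff_const_mul]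
    have e1 := h₁ x (hx x hx').2 t ε hε ht1 ht2
    have e2 := h₂ x (hx x hx').2 t ε hε ht1 ht2
    have b1 := hb₁ x (hx x hx').2
    have b2 := hb₂ x (hx x hx').2
    rw [pow_one] at b1
    rw [show p * (a * (a - 1) * x ^ (a - 2)) = p * (a * (a - 1)) * x ^ (a - 2) by ring,
      show p * (p - 1) * (a * x ^ (a - 1)) ^ 2 = p * (p - 1) * a ^ 2 * (x ^ (a - 1)) ^ 2 by ring]
    refine (abs_add_le _ _).trans ?_
    rw [abs_mul _ (secondDiff _ _ _), abs_mul _ (secondDiff _ _ _)]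
    have m1 := mul_le_mul b1 e1 (abs_nonneg _) hM₁
    have m2 := mul_le_mul b2 e2 (abs_nonneg _) hM₂
    linarith

end SumOfPowers

/-! ### Decay of the covariance of fractional second order increments -/

section FractionalSecondDifferences

/-- Covariance function of the (unnormalized) second order increments of fractional Brownian motion
with Hurst parameter `h`: minus the fourth difference of `|·|^{2h}`. -/
noncomputable def fbmCov (h : ℝ) (m : ℤ) : ℝ :=
  -(|(m : ℝ) - 2| ^ (2 * h) - 4 * |(m : ℝ) - 1| ^ (2 * h) + 6 * |(m : ℝ)| ^ (2 * h)
    - 4 * |(m : ℝ) + 1| ^ (2 * h) + |(m : ℝ) + 2| ^ (2 * h))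

lemma fbmCov_neg (h : ℝ) (m : ℤ) : fbmCov h (-m) = fbmCov h m := by
  have e : ∀ y : ℝ, |-(m : ℝ) - y| = |(m : ℝ) + y| := fun y => by
    rw [← abs_neg]; congr 1; ring
  have e' : ∀ y : ℝ, |-(m : ℝ) + y| = |(m : ℝ) - y| := fun y => by
    rw [← abs_neg]; congr 1; ring
  simp only [fbmCov, Int.cast_neg, e, e', abs_neg]
  ring

lemma hasDerivAt_const_mul_rpow (c b : ℝ) {x : ℝ} (hx : 0 < x) :
    HasDerivAt (fun x : ℝ => c * x ^ b) (c * b * x ^ (b - 1)) x := by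
  have := (Real.hasDerivAt_rpow_const (x := x) (p := b) (Or.inl hx.ne')).const_mul c
  rwa [← mul_assoc] at this

/-- A fourth difference is an iterated second difference, hence controlled by the fourth derivative,
of order `z^(2h-4) ≤ z⁻²`. The offset 3 keeps the evaluation points at `z ≥ n + 1`, away from the
singularity; the factor 4 comes from two uses of `abs_secondDiff_le`. -/
lemma abs_fbmCov_le {h : ℝ} (h1 : h < 1) (n : ℕ) :
    |fbmCov h (n + 3 : ℕ)|
      ≤ 4 * |2 * h * (2 * h - 1) * (2 * h - 2) * (2 * h - 3)| * (1 / ((n + 1 : ℕ) : ℝ) ^ 2) := by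
  set a := 2 * h with ha
  set c := |a * (a - 1) * (a - 2) * (a - 3)| with hc
  have hn : (0 : ℝ) ≤ n := Nat.cast_nonneg n
  set x : ℝ := ((n + 3 : ℕ) : ℝ) with hx
  have hxn : x = n + 3 := by rw [hx]; push_cast; ring
  have hr : fbmCov h (n + 3 : ℕ) = -secondDiff (fun y => secondDiff (fun z => z ^ a) y 1) x 1 := by
    simp only [fbmCov, secondDiff, Int.cast_natCast, ← hx, ← ha]
    rw [abs_of_pos (by linarith), abs_of_pos (by linarith), abs_of_pos (by linarith),
      abs_of_pos (by linarith), abs_of_pos (by linarith), show x + 1 + 1 = x + 2 by ring,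
      show x + 1 - 1 = x by ring, show x - 1 + 1 = x by ring, show x - 1 - 1 = x - 2 by ring]
    ring
  rw [hr, abs_neg]
  have hshift : ∀ (c b : ℝ) (y : ℝ), 1 < y →
      HasDerivAt (fun y => secondDiff (fun z => c * z ^ b) y 1)
        (secondDiff (fun z => c * b * z ^ (b - 1)) y 1) y := by
    intro c b y hy
    exact (((hasDerivAt_const_mul_rpow c b (by linarith)).comp_add_const y 1).add
      ((hasDerivAt_const_mul_rpow c b (by linarith)).comp_sub_const y 1)).sub
      ((hasDerivAt_const_mul_rpow c b (by linarith)).const_mul 2)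
  have key := abs_secondDiff_le (f := fun y => secondDiff (fun z => 1 * z ^ a) y 1) (x := x) (δ := 1)
    (M := 2 * (c * (1 / ((n + 1 : ℕ) : ℝ) ^ 2)) * 1 ^ 2) zero_le_one
    (fun y hy => hshift _ _ y (by linarith [hy.1]))
    (fun y hy => hshift _ _ y (by linarith [hy.1]))
    (fun y hy => ?_)
  · simp only [one_mul] at key
    linarith
  · refine abs_secondDiff_le zero_le_one
      (fun z hz => hasDerivAt_const_mul_rpow _ _ (by linarith [hy.1, hz.1]))
      (fun z hz => hasDerivAt_const_mul_rpow _ _ (by linarith [hy.1, hz.1]))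
      (fun z hz => ?_)
    have hz1 : (n : ℝ) + 1 ≤ z := by linarith [hy.1, hz.1]
    rw [abs_mul, show 1 * a * (a - 1) * (a - 1 - 1) * (a - 1 - 1 - 1)
      = a * (a - 1) * (a - 2) * (a - 3) by ring, ← hc]
    refine mul_le_mul_of_nonneg_left ?_ (abs_nonneg _)
    rw [abs_of_nonneg (Real.rpow_nonneg (by linarith) _)]
    calc z ^ (a - 1 - 1 - 1 - 1) ≤ z ^ (-2 : ℝ) :=
          Real.rpow_le_rpow_of_exponent_le (by linarith) (by linarith)
      _ ≤ ((n : ℝ) + 1) ^ (-2 : ℝ) :=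
          Real.rpow_le_rpow_of_nonpos (by linarith) hz1 (by norm_num)
      _ = 1 / ((n + 1 : ℕ) : ℝ) ^ 2 := by
          rw [Real.rpow_neg (by linarith)]
          push_cast
          norm_num

lemma summable_abs_fbmCov {h : ℝ} (h1 : h < 1) : Summable fun m : ℤ => |fbmCov h m| := by
  have hnat : Summable fun n : ℕ => |fbmCov h n| := by
    rw [← summable_nat_add_iff 3]
    refine Summable.of_nonneg_of_le (fun n => abs_nonneg _) (fun n => abs_fbmCov_le h1 n) ?_
    exact ((summable_nat_add_iff 1).2 (Real.summable_one_div_nat_pow.2 one_lt_two)).mul_left _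
  refine Summable.of_nat_of_neg hnat ?_
  simpa only [fbmCov_neg] using hnat

end FractionalSecondDifferences

/-! ### Averages and row sums of nearly Toeplitz arrays -/

section ToeplitzSums

lemma abs_le_tsum_abs {q : ℤ → ℝ} (hq : Summable fun m => |q m|) (m : ℤ) : |q m| ≤ ∑' m, |q m| :=
  hq.le_tsum m fun _ _ => abs_nonneg _

lemma summable_mul_of_summable_abs {p q : ℤ → ℝ} (hp : Summable fun m => |p m|)
    (hq : Summable fun m => |q m|) : Summable fun m => p m * q m := by
  refine Summable.of_norm_bounded (hp.mul_right (∑' m, |q m|)) fun m => ?_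
  rw [Real.norm_eq_abs, abs_mul]
  exact mul_le_mul_of_nonneg_left (abs_le_tsum_abs hq m) (abs_nonneg _)

lemma summable_sq_of_summable_abs {q : ℤ → ℝ} (hq : Summable fun m => |q m|) :
    Summable fun m => q m ^ 2 := by
  simpa only [pow_two] using summable_mul_of_summable_abs hq hq

/-- Row `i` is cut at `j = a i`: the left piece depends only on `i`, the right piece only on `n -
i`. -/
lemma sum_Ico_comp_sub_eq (f : ℤ → ℝ) {a n i : ℕ} (ha : 1 ≤ a) (hi : i < n) :
    ∑ j ∈ Finset.Ico 1 (a * n), f ((a : ℤ) * i - j)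
      = ∑ m ∈ Finset.range (a * i), f m
        + ∑ l ∈ Finset.range (a * (n - i) - 1), f (-((l : ℤ) + 1)) := by
  have h1 : a * i + 1 ≤ a * n := by nlinarith
  rw [← Finset.sum_Ico_consecutive _ (show 1 ≤ a * i + 1 by omega) h1]
  congr 1
  · refine Finset.sum_nbij' (fun j => a * i - j) (fun m => a * i - m) ?_ ?_ ?_ ?_ ?_
    · intro j hj; simp only [Finset.mem_Ico, Finset.mem_range] at hj ⊢; omega
    · intro j hj; simp only [Finset.mem_Ico, Finset.mem_range] at hj ⊢; omega
    · intro j hj; simp only [Finset.mem_Ico] at hj; omega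
    · intro j hj; simp only [Finset.mem_range] at hj; omega
    · intro j hj
      simp only [Finset.mem_Ico] at hj
      congr 1
      rw [Nat.cast_sub (by omega)]
      push_cast; ring
  · rw [Finset.sum_Ico_eq_sum_range, Nat.mul_sub, show a * n - (a * i + 1) = a * n - a * i - 1 by omega]
    refine Finset.sum_congr rfl fun l _ => ?_
    congr 1
    push_cast; ring

/-- Cesàro averages of a summable function of the distance to the line `j = a i`. -/
lemma tendsto_toeplitz_average {f : ℤ → ℝ} (hf : Summable f) {a : ℕ} (ha : 1 ≤ a) :
    Tendsto (fun n : ℕ => (n : ℝ)⁻¹ * ∑ i ∈ Finset.Ico 1 n, ∑ j ∈ Finset.Ico 1 (a * n),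
      f ((a : ℤ) * i - j)) atTop (𝓝 (∑' m, f m)) := by
  -- `V i` joins the left piece of row `i` to the right piece of row `n - i`. It does not depend on
  -- `n` and tends to the full sum, so Cesàro's theorem applies.
  set V : ℕ → ℝ := fun i => ∑ m ∈ Finset.range (a * i), f m
    + ∑ l ∈ Finset.range (a * i - 1), f (-((l : ℤ) + 1)) with hV
  have hpos : Summable fun n : ℕ => f n := hf.comp_injective Nat.cast_injective
  have hneg : Summable fun n : ℕ => f (-((n : ℤ) + 1)) :=
    hf.comp_injective fun x y h => by simpa using h
  have hai : Tendsto (fun i : ℕ => a * i) atTop atTop :=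
    tendsto_atTop_mono (fun i => Nat.le_mul_of_pos_left i ha) tendsto_id
  have hVlim : Tendsto V atTop (𝓝 (∑' m, f m)) := by
    rw [tsum_of_nat_of_neg_add_one hpos hneg]
    exact (hpos.hasSum.tendsto_sum_nat.comp hai).add
      (hneg.hasSum.tendsto_sum_nat.comp ((tendsto_sub_atTop_nat 1).comp hai))
  refine hVlim.cesaro.congr fun n => ?_
  congr 1
  rcases Nat.eq_zero_or_pos n with rfl | hn
  · simp
  -- The term `i = 0` vanishes because the truncated subtraction `a * 0 - 1` is `0`.
  have e1 : ∑ i ∈ Finset.range n, V i = ∑ i ∈ Finset.Ico 1 n, V i := by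
    rw [Finset.range_eq_Ico, Finset.sum_eq_sum_Ico_succ_bot hn]
    simp [hV]
  rw [e1, hV]
  simp only
  rw [Finset.sum_congr rfl fun i hi => sum_Ico_comp_sub_eq f ha (Finset.mem_Ico.1 hi).2,
    Finset.sum_add_distrib, Finset.sum_add_distrib]
  congr 1
  refine Finset.sum_nbij' (fun i => n - i) (fun i => n - i) ?_ ?_ ?_ ?_ ?_
  · intro j hj; simp only [Finset.mem_Ico] at hj ⊢; omega
  · intro j hj; simp only [Finset.mem_Ico] at hj ⊢; omega
  · intro j hj; simp only [Finset.mem_Ico] at hj; omega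
  · intro j hj; simp only [Finset.mem_Ico] at hj; omega
  · intro j hj
    simp only [Finset.mem_Ico] at hj
    rw [show n - (n - j) = j by omega]

/-- Averages of squares of an approximately Toeplitz array. -/
lemma tendsto_average_sq {q : ℤ → ℝ} (hq : Summable fun m => |q m|) {a : ℕ} (ha : 1 ≤ a)
    {S : ℕ → ℕ → ℕ → ℝ} {C : ℝ} (hS : ∀ n, ∀ i ∈ Finset.Ico 1 n, ∀ j ∈ Finset.Ico 1 (a * n),
      |S n i j - q ((a : ℤ) * i - j)| ≤ C / (n : ℝ) ^ 2) :
    Tendsto (fun n : ℕ => (n : ℝ)⁻¹ * ∑ i ∈ Finset.Ico 1 n, ∑ j ∈ Finset.Ico 1 (a * n),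
      S n i j ^ 2) atTop (𝓝 (∑' m, q m ^ 2)) := by
  have h1 := tendsto_toeplitz_average (summable_sq_of_summable_abs hq) ha
  set B := ∑' m, |q m| with hB
  have hB0 : 0 ≤ B := tsum_nonneg fun _ => abs_nonneg _
  have hdiff : Tendsto (fun n : ℕ => (n : ℝ)⁻¹ * ∑ i ∈ Finset.Ico 1 n, ∑ j ∈ Finset.Ico 1 (a * n),
      S n i j ^ 2 - (n : ℝ)⁻¹ * ∑ i ∈ Finset.Ico 1 n, ∑ j ∈ Finset.Ico 1 (a * n),
      q ((a : ℤ) * i - j) ^ 2) atTop (𝓝 0) := by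
    -- There are at most `a n²` entries; each squared entry is off by at most `|C| (2B + |C|) / n²`,
    -- and the average carries a factor `1 / n`.
    have hlim : Tendsto (fun n : ℕ => (a * (|C| * (2 * B + |C|))) / (n : ℝ)) atTop (𝓝 0) :=
      tendsto_const_div_atTop_nhds_zero_nat _
    refine squeeze_zero_norm' ?_ hlim
    filter_upwards [eventually_gt_atTop 0] with n hn
    have hn' : (1 : ℝ) ≤ n := by exact_mod_cast hn
    have hn0 : (0 : ℝ) < n := by linarith
    rw [← mul_sub, ← Finset.sum_sub_distrib, norm_mul, Real.norm_of_nonneg (by positivity)]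
    have hterm : ∀ i ∈ Finset.Ico 1 n, ∀ j ∈ Finset.Ico 1 (a * n),
        |S n i j ^ 2 - q ((a : ℤ) * i - j) ^ 2| ≤ |C| * (2 * B + |C|) / (n : ℝ) ^ 2 := by
      intro i hi j hj
      have e1 := hS n i hi j hj
      have e2 := abs_le_tsum_abs hq ((a : ℤ) * i - j)
      rw [← hB] at e2
      set x := S n i j
      set y := q ((a : ℤ) * i - j)
      have e3 : C / (n : ℝ) ^ 2 ≤ |C| / (n : ℝ) ^ 2 := by gcongr; exact le_abs_self C
      have e4 : |C| / (n : ℝ) ^ 2 ≤ |C| := div_le_self (abs_nonneg _) (by nlinarith)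
      have e5 : |x + y| ≤ 2 * B + |C| := by
        calc |x + y| = |(x - y) + 2 * y| := by ring_nf
          _ ≤ |x - y| + |2 * y| := abs_add_le _ _
          _ ≤ _ := by rw [abs_mul, abs_two]; linarith
      calc |x ^ 2 - y ^ 2| = |x - y| * |x + y| := by rw [← abs_mul]; ring_nf
        _ ≤ (|C| / (n : ℝ) ^ 2) * (2 * B + |C|) :=
            mul_le_mul (e1.trans e3) e5 (abs_nonneg _) (by positivity)
        _ = _ := by ring
    calc (n : ℝ)⁻¹ * ‖∑ i ∈ Finset.Ico 1 n, (∑ j ∈ Finset.Ico 1 (a * n), S n i j ^ 2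
            - ∑ j ∈ Finset.Ico 1 (a * n), q ((a : ℤ) * i - j) ^ 2)‖
        ≤ (n : ℝ)⁻¹ * ∑ i ∈ Finset.Ico 1 n, ∑ j ∈ Finset.Ico 1 (a * n),
            |C| * (2 * B + |C|) / (n : ℝ) ^ 2 := by
          gcongr
          refine norm_sum_le_of_le _ fun i hi => ?_
          rw [← Finset.sum_sub_distrib]
          exact norm_sum_le_of_le _ fun j hj => hterm i hi j hj
      _ ≤ (n : ℝ)⁻¹ * (n * ((a * n) * (|C| * (2 * B + |C|) / (n : ℝ) ^ 2))) := by
          simp only [Finset.sum_const, Nat.card_Ico, nsmul_eq_mul]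
          have c1 : ((n - 1 : ℕ) : ℝ) ≤ n := by exact_mod_cast Nat.sub_le _ _
          have c2 : ((a * n - 1 : ℕ) : ℝ) ≤ a * n := by exact_mod_cast Nat.sub_le _ _
          gcongr
      _ = _ := by field_simp
  simpa using hdiff.add h1

lemma sum_abs_comp_le_tsum {q : ℤ → ℝ} (hq : Summable fun m => |q m|) {s : Finset ℕ} {g : ℕ → ℤ}
    (hg : Function.Injective g) : ∑ j ∈ s, |q (g j)| ≤ ∑' m, |q m| := by
  rw [← Finset.sum_image (f := fun m => |q m|) (g := g) (fun x _ y _ h => hg h)]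
  exact hq.sum_le_tsum _ fun _ _ => abs_nonneg _

/-- Uniform bound on the row sums of an approximately Toeplitz array. -/
lemma sum_abs_le_of_abs_sub_le {q : ℤ → ℝ} (hq : Summable fun m => |q m|) {n a : ℕ} (hn : 1 ≤ n)
    {s : Finset ℕ} (hs : s.card ≤ a * n) {g : ℕ → ℤ} (hg : Function.Injective g) {R : ℕ → ℝ} {C : ℝ}
    (hR : ∀ j ∈ s, |R j - q (g j)| ≤ C / (n : ℝ) ^ 2) :
    ∑ j ∈ s, |R j| ≤ ∑' m, |q m| + a * |C| := by
  have hn' : (1 : ℝ) ≤ n := by exact_mod_cast hn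
  have hn0 : (0 : ℝ) < n := by linarith
  have h1 : ∀ j ∈ s, |R j| ≤ |q (g j)| + |C| / (n : ℝ) ^ 2 := fun j hj => by
    have e1 : C / (n : ℝ) ^ 2 ≤ |C| / (n : ℝ) ^ 2 := by gcongr; exact le_abs_self C
    have e2 := abs_sub_abs_le_abs_sub (R j) (q (g j))
    linarith [hR j hj]
  refine (Finset.sum_le_sum h1).trans ?_
  rw [Finset.sum_add_distrib, Finset.sum_const, nsmul_eq_mul]
  refine add_le_add (sum_abs_comp_le_tsum hq hg) ?_
  have hs' : (s.card : ℝ) ≤ a * n := by exact_mod_cast hs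
  calc (s.card : ℝ) * (|C| / (n : ℝ) ^ 2) ≤ (a * n) * (|C| / (n : ℝ) ^ 2) := by gcongr
    _ = a * |C| / n := by field_simp
    _ ≤ a * |C| := div_le_self (by positivity) hn'

end ToeplitzSums

/-! ### Identification of the variance series -/

section AsymptoticVarianceSeries

lemma tsum_int_eq_of_even {f : ℤ → ℝ} (hf : Summable f) (heven : ∀ m, f (-m) = f m) :
    ∑' m, f m = f 0 + 2 * ∑' n : ℕ, f (n + 1) := by
  have hpos : Summable fun n : ℕ => f n := hf.comp_injective Nat.cast_injective
  have hneg : Summable fun n : ℕ => f (-((n : ℤ) + 1)) :=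
    hf.comp_injective fun x y h => by simpa using h
  rw [tsum_of_nat_of_neg_add_one hpos hneg, hpos.tsum_eq_zero_add]
  simp only [heven]
  push_cast
  ring

variable {h : ℝ}

/-- Covariance function between the second order increments on two nested grids. -/
noncomputable def fbmCrossCov (h : ℝ) (m : ℤ) : ℝ :=
  fbmCov h (m + 1) + 2 * fbmCov h m + fbmCov h (m - 1)

lemma fbmCov_zero (h0 : 0 < h) : fbmCov h 0 = 2 * (4 - (2 : ℝ) ^ (2 * h)) := by
  have : (0 : ℝ) ^ (2 * h) = 0 := Real.zero_rpow (by positivity)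
  simp [fbmCov, this]
  ring

lemma fbmCov_one (h0 : 0 < h) : fbmCov h 1 = (2 : ℝ) ^ (2 * h + 2) - 7 - (3 : ℝ) ^ (2 * h) := by
  have e0 : (0 : ℝ) ^ (2 * h) = 0 := Real.zero_rpow (by positivity)
  have e1 : (2 : ℝ) ^ (2 * h + 2) = 4 * 2 ^ (2 * h) := by
    rw [Real.rpow_add (by norm_num)]; norm_num; ring
  rw [e1]
  simp only [fbmCov, Int.cast_one]
  norm_num
  rw [e0]
  ring

lemma fbmCov_half (l : ℕ) : fbmCov (1 / 2) (l + 2 : ℕ) = 0 := by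
  have hl : (0 : ℝ) ≤ l := Nat.cast_nonneg l
  simp only [fbmCov, Int.cast_natCast]
  push_cast
  rw [show 2 * (1 / 2 : ℝ) = 1 by norm_num]
  simp only [Real.rpow_one]
  rw [abs_of_nonneg (by linarith), abs_of_nonneg (by linarith), abs_of_nonneg (by linarith),
    abs_of_nonneg (by linarith), abs_of_nonneg (by linarith)]
  ring

/-- For `h ≠ 1/2` the product `p_h ρ` is `-fbmCov h`, and the signs cancel. At `h = 1/2` the left
side vanishes through `2h - 1`, and the right side because Brownian second order increments at lag
at least 2 are uncorrelated. This is why one index is `l + 2`. -/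
lemma fbmFactor_mul_rhoGamma_mul (h0 : 0 < h) (h1 : h < 1) (k l : ℕ) :
    fbmFactor h * (rhoGamma (2 - 2 * h) (l + 2) * rhoGamma (2 - 2 * h) k)
      = fbmCov h (l + 2 : ℕ) * fbmCov h k := by
  by_cases hh : h = 1 / 2
  · subst hh
    rw [fbmCov_half]
    norm_num [fbmFactor]
  · have hγ : (2 - 2 * h) ≠ 1 := fun e => hh (by linarith)
    have key : ∀ m : ℕ, (2 * h) * (2 * h - 1) * (2 * h - 2) * (2 * h - 3) * rhoGamma (2 - 2 * h) m
        = -fbmCov h m := by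
      intro m
      rw [rhoGamma, if_neg hγ, fbmCov, show 2 - (2 - 2 * h) = 2 * h by ring,
        show (2 - 2 * h - 2) * (2 - 2 * h - 1) * (2 - 2 * h) * (2 - 2 * h + 1)
          = (2 * h) * (2 * h - 1) * (2 * h - 2) * (2 * h - 3) by ring, mul_div_cancel₀]
      · simp
      · have : 2 * h - 1 ≠ 0 := fun e => hh (by linarith)
        have : 2 * h - 2 ≠ 0 := fun e => by linarith
        have : 2 * h - 3 ≠ 0 := fun e => by linarith
        have : 2 * h ≠ 0 := by positivity
        positivity
    have k1 := key (l + 2)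
    have k2 := key k
    calc _ = ((2 * h) * (2 * h - 1) * (2 * h - 2) * (2 * h - 3) * rhoGamma (2 - 2 * h) (l + 2))
          * ((2 * h) * (2 * h - 1) * (2 * h - 2) * (2 * h - 3) * rhoGamma (2 - 2 * h) k) := by
          rw [fbmFactor]; ring
      _ = _ := by rw [k1, k2]; ring

lemma summable_int_comp_add {f : ℤ → ℝ} (hf : Summable f) (k : ℤ) :
    Summable fun m : ℤ => f (m + k) :=
  hf.comp_injective (i := fun m : ℤ => m + k) (add_left_injective k)

lemma summable_fbmCov_mul_shift (h1 : h < 1) (k : ℤ) :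
    Summable fun m : ℤ => fbmCov h m * fbmCov h (m + k) :=
  summable_mul_of_summable_abs (q := fun m => fbmCov h (m + k)) (summable_abs_fbmCov h1)
    (summable_int_comp_add (summable_abs_fbmCov h1) k)

lemma summable_nat_fbmCov_mul_shift (h1 : h < 1) (k j : ℤ) :
    Summable fun n : ℕ => fbmCov h (n + j) * fbmCov h (n + j + k) :=
  (summable_fbmCov_mul_shift h1 k).comp_injective (i := fun n : ℕ => (n : ℤ) + j)
    fun x y e => by simpa using e

lemma tsum_fbmCov_sq (h0 : 0 < h) (h1 : h < 1) :
    ∑' m : ℤ, fbmCov h m ^ 2 = 2 * sigmaSqFBM h := by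
  have hs : Summable fun m : ℤ => fbmCov h m ^ 2 :=
    summable_sq_of_summable_abs (summable_abs_fbmCov h1)
  rw [tsum_int_eq_of_even hs fun m => by rw [fbmCov_neg]]
  have hs' : Summable fun n : ℕ => fbmCov h (n + 1) ^ 2 := by
    simpa [pow_two] using summable_nat_fbmCov_mul_shift h1 0 1
  rw [hs'.tsum_eq_zero_add, sigmaSqFBM, ← tsum_mul_left]
  have e : ∀ l : ℕ, fbmFactor h * rhoGamma (2 - 2 * h) (l + 2) ^ 2
      = fbmCov h (((l + 1 : ℕ) : ℤ) + 1) ^ 2 := by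
    intro l
    rw [pow_two, fbmFactor_mul_rhoGamma_mul h0 h1, pow_two]
    norm_cast
  simp_rw [e]
  simp only [Nat.cast_zero, zero_add, fbmCov_zero h0, fbmCov_one h0]
  ring

/-- The reflection `m ↦ -1 - m` preserves the summand, so the sum is twice its part over `m ≥ 0`;
the term `m = 0` is the closed-form summand of `sigmaSqCovTwoFBM`. -/
lemma tsum_fbmCov_mul_succ (h0 : 0 < h) (h1 : h < 1) :
    ∑' m : ℤ, fbmCov h m * fbmCov h (m + 1) = 2 * sigmaSqCovTwoFBM h := by
  have hs := summable_fbmCov_mul_shift h1 1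
  have hpos : Summable fun n : ℕ => fbmCov h n * fbmCov h (n + 1) :=
    hs.comp_injective (i := fun n : ℕ => (n : ℤ)) Nat.cast_injective
  have e : ∀ n : ℕ, fbmCov h (-((n : ℤ) + 1)) * fbmCov h (-((n : ℤ) + 1) + 1)
      = fbmCov h n * fbmCov h (n + 1) := by
    intro n
    rw [fbmCov_neg, show -((n : ℤ) + 1) + 1 = -n by ring, fbmCov_neg, mul_comm]
  rw [tsum_of_nat_of_neg_add_one (f := fun m : ℤ => fbmCov h m * fbmCov h (m + 1)) hpos
    (hpos.congr fun n => (e n).symm), tsum_congr e]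
  rw [← two_mul, hpos.tsum_eq_zero_add, sigmaSqCovTwoFBM, ← tsum_mul_left]
  have e2 : ∀ l : ℕ, fbmFactor h * (rhoGamma (2 - 2 * h) (l + 2) * rhoGamma (2 - 2 * h) (l + 1))
      = fbmCov h ((l + 1 : ℕ) : ℤ) * fbmCov h (((l + 1 : ℕ) : ℤ) + 1) := by
    intro l
    rw [fbmFactor_mul_rhoGamma_mul h0 h1, mul_comm]
    norm_cast
  simp_rw [e2]
  simp only [Nat.cast_zero, zero_add, fbmCov_zero h0, fbmCov_one h0]
  ring

/-- Shifting by one makes the summand even. Its central term `fbmCov h (-1) * fbmCov h 1` is counted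
once, which explains the coefficient `1 / 2` in `sigmaSqCovOneFBM`. -/
lemma tsum_fbmCov_mul_succ_succ (h0 : 0 < h) (h1 : h < 1) :
    ∑' m : ℤ, fbmCov h m * fbmCov h (m + 2) = 2 * sigmaSqCovOneFBM h := by
  have hs : Summable fun m : ℤ => fbmCov h (m - 1) * fbmCov h (m + 1) := by
    refine (summable_int_comp_add (summable_fbmCov_mul_shift h1 2) (-1)).congr fun m => ?_
    rw [show m + -1 + 2 = m + 1 by ring, sub_eq_add_neg]
  have e0 : ∑' m : ℤ, fbmCov h m * fbmCov h (m + 2)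
      = ∑' m : ℤ, fbmCov h (m - 1) * fbmCov h (m + 1) := by
    rw [← (Equiv.subRight (1 : ℤ)).tsum_eq]
    refine tsum_congr fun m => ?_
    change fbmCov h (m - 1) * fbmCov h (m - 1 + 2) = _
    rw [show m - 1 + 2 = m + 1 by ring]
  rw [e0, tsum_int_eq_of_even hs]
  · rw [sigmaSqCovOneFBM, ← tsum_mul_left (a := fbmFactor h)]
    have e2 : ∀ l : ℕ, fbmFactor h * (rhoGamma (2 - 2 * h) (l + 2) * rhoGamma (2 - 2 * h) l)
        = fbmCov h ((l : ℤ) + 1 - 1) * fbmCov h ((l : ℤ) + 1 + 1) := by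
      intro l
      rw [fbmFactor_mul_rhoGamma_mul h0 h1, mul_comm, add_sub_cancel_right]
      norm_cast
    simp_rw [e2]
    rw [zero_sub, zero_add, fbmCov_neg, fbmCov_one h0]
    ring
  · intro m
    rw [show -m - 1 = -(m + 1) by ring, show -m + 1 = -(m - 1) by ring, fbmCov_neg, fbmCov_neg,
      mul_comm]

lemma summable_abs_fbmCrossCov (h1 : h < 1) : Summable fun m : ℤ => |fbmCrossCov h m| := by
  have hs := summable_abs_fbmCov h1
  have h2 := summable_int_comp_add hs 1
  have h3 := summable_int_comp_add hs (-1)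
  refine Summable.of_nonneg_of_le (fun _ => abs_nonneg _) (fun m => ?_)
    ((h2.add (hs.mul_left 2)).add h3)
  rw [fbmCrossCov, sub_eq_add_neg]
  refine (abs_add_le _ _).trans (add_le_add ((abs_add_le _ _).trans ?_) le_rfl)
  rw [abs_mul, abs_two]

/-- Expanding `(r (m+1) + 2 r m + r (m-1))²` gives total coefficients 6, 8 and 2 for the correlation
sums at lags 0, 1 and 2. -/
lemma tsum_fbmCrossCov_sq (h0 : 0 < h) (h1 : h < 1) :
    ∑' m : ℤ, fbmCrossCov h m ^ 2 = 4 * sigmaSqStarFBM h := by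
  set r := fbmCov h
  have hshift : ∀ k j : ℤ, HasSum (fun m : ℤ => r (m + j) * r (m + j + k))
      (∑' m : ℤ, r m * r (m + k)) := fun k j =>
    (Equiv.addRight j).hasSum_iff.2 (summable_fbmCov_mul_shift h1 k).hasSum
  have hsum := ((((hshift 0 1).add ((hshift 0 0).mul_left 4)).add (hshift 0 (-1))).add
    (((hshift 1 0).mul_left 4).add ((hshift 1 (-1)).mul_left 4))).add ((hshift 2 (-1)).mul_left 2)
  have e0 : ∑' m : ℤ, r m * r (m + 0) = 2 * sigmaSqFBM h := by
    rw [← tsum_fbmCov_sq h0 h1]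
    exact tsum_congr fun m => by rw [add_zero, pow_two]
  rw [e0, tsum_fbmCov_mul_succ h0 h1, tsum_fbmCov_mul_succ_succ h0 h1] at hsum
  have e1 : (fun m : ℤ => fbmCrossCov h m ^ 2) = fun b : ℤ =>
      r (b + 1) * r (b + 1 + 0) + 4 * (r (b + 0) * r (b + 0 + 0)) + r (b + -1) * r (b + -1 + 0)
        + (4 * (r (b + 0) * r (b + 0 + 1)) + 4 * (r (b + -1) * r (b + -1 + 1)))
        + 2 * (r (b + -1) * r (b + -1 + 2)) := by
    ext m
    rw [show m + -1 + 1 = m by ring, show m + -1 + 2 = m + 1 by ring, ← sub_eq_add_neg]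
    simp only [add_zero, fbmCrossCov]
    ring
  rw [e1, hsum.tsum_eq, sigmaSqStarFBM]
  ring

end AsymptoticVarianceSeries

/-! ### Covariances of the scaled increments -/

section Increments

lemma secondDiff_congr {f g : ℝ → ℝ} {x δ : ℝ} (hδ : 0 ≤ δ)
    (h : ∀ y ∈ Set.Icc (x - δ) (x + δ), f y = g y) : secondDiff f x δ = secondDiff g x δ := by
  rw [secondDiff, secondDiff, h _ ⟨by linarith, le_rfl⟩, h _ ⟨le_rfl, by linarith⟩,
    h x ⟨by linarith, by linarith⟩]

lemma abs_mul_rpow {δ : ℝ} (hδ : 0 ≤ δ) (x p : ℝ) : |δ * x| ^ p = δ ^ p * |x| ^ p := by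
  rw [abs_mul, abs_of_nonneg hδ, Real.mul_rpow hδ (abs_nonneg _)]

lemma secondDiff_secondDiff_abs_sub_rpow {h δ s t : ℝ} (hδ : 0 ≤ δ) {m : ℤ} (hst : s - t = δ * m) :
    secondDiff (fun x => secondDiff (fun y => |x - y| ^ (2 * h)) t δ) s δ
      = -(δ ^ (2 * h) * fbmCov h m) := by
  have hs : s = t + δ * m := by linarith
  subst hs
  simp only [secondDiff, fbmCov]
  rw [show t + δ * m + δ - (t + δ) = δ * m by ring, show t + δ * m + δ - (t - δ) = δ * (m + 2) by ring,
    show t + δ * m + δ - t = δ * (m + 1) by ring, show t + δ * m - δ - (t + δ) = δ * (m - 2) by ring,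
    show t + δ * m - δ - (t - δ) = δ * m by ring, show t + δ * m - δ - t = δ * (m - 1) by ring,
    show t + δ * m - (t + δ) = δ * (m - 1) by ring, show t + δ * m - (t - δ) = δ * (m + 1) by ring,
    show t + δ * m - t = δ * m by ring]
  simp only [abs_mul_rpow hδ]
  ring

/-- A second difference of step `2δ` is the combination, with weights 1, 2, 1, of second differences
of step `δ` at three neighbouring points. This is the form of `fbmCrossCov`. -/
lemma secondDiff_secondDiff_abs_sub_rpow_two_mul {h δ s t : ℝ} (hδ : 0 ≤ δ) {m : ℤ}
    (hst : s - t = δ * m) :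
    secondDiff (fun x => secondDiff (fun y => |x - y| ^ (2 * h)) t δ) s (2 * δ)
      = -(δ ^ (2 * h) * fbmCrossCov h m) := by
  have hs : s = t + δ * m := by linarith
  subst hs
  simp only [secondDiff, fbmCrossCov, fbmCov, Int.cast_add, Int.cast_sub, Int.cast_one]
  rw [show t + δ * m + 2 * δ - (t + δ) = δ * (m + 1) by ring,
    show t + δ * m + 2 * δ - (t - δ) = δ * (m + 3) by ring,
    show t + δ * m + 2 * δ - t = δ * (m + 2) by ring,
    show t + δ * m - 2 * δ - (t + δ) = δ * (m - 3) by ring,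
    show t + δ * m - 2 * δ - (t - δ) = δ * (m - 1) by ring,
    show t + δ * m - 2 * δ - t = δ * (m - 2) by ring,
    show t + δ * m - (t + δ) = δ * (m - 1) by ring, show t + δ * m - (t - δ) = δ * (m + 1) by ring,
    show t + δ * m - t = δ * m by ring,
    show (m : ℝ) + 1 - 2 = m - 1 by ring, show (m : ℝ) + 1 - 1 = m by ring,
    show (m : ℝ) + 1 + 1 = m + 2 by ring, show (m : ℝ) + 1 + 2 = m + 3 by ring,
    show (m : ℝ) - 1 - 2 = m - 3 by ring, show (m : ℝ) - 1 - 1 = m - 2 by ring,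
    show (m : ℝ) - 1 + 1 = m by ring, show (m : ℝ) - 1 + 2 = m + 1 by ring]
  simp only [abs_mul_rpow hδ]
  ring

variable {Ω : Type*} [MeasurableSpace Ω] {P : Measure Ω}

lemma memLp_secondDiff {X : ℝ → Ω → ℝ} (hX : ∀ t, MemLp (X t) 2 P) (s δ : ℝ) :
    MemLp (fun ω => secondDiff (fun t => X t ω) s δ) 2 P :=
  ((hX (s + δ)).add (hX (s - δ))).sub ((hX s).const_mul 2)

lemma covariance_secondDiff_left [IsFiniteMeasure P] {X : ℝ → Ω → ℝ} (hX : ∀ t, MemLp (X t) 2 P) {Z : Ω → ℝ}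
    (hZ : MemLp Z 2 P) (s δ : ℝ) :
    cov[fun ω => secondDiff (fun t => X t ω) s δ, Z; P] = secondDiff (fun x => cov[X x, Z; P]) s δ := by
  simp only [secondDiff]
  rw [covariance_fun_sub_left (X := fun ω => X (s + δ) ω + X (s - δ) ω) (Y := fun ω => 2 * X s ω)
      ((hX _).add (hX _)) ((hX s).const_mul 2) hZ, covariance_const_mul_left]
  congr 1
  exact covariance_add_left (hX _) (hX _) hZ

lemma covariance_secondDiff_secondDiff [IsFiniteMeasure P] {X : ℝ → Ω → ℝ} (hX : ∀ t, MemLp (X t) 2 P) (s δ t ε : ℝ) :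
    cov[fun ω => secondDiff (fun t => X t ω) s δ, fun ω => secondDiff (fun t => X t ω) t ε; P]
      = secondDiff (fun x => secondDiff (fun y => cov[X x, X y; P]) t ε) s δ := by
  rw [covariance_secondDiff_left hX (memLp_secondDiff hX t ε)]
  congr 1
  ext x
  rw [covariance_comm, covariance_secondDiff_left hX (hX x)]
  congr 1
  ext y
  exact covariance_comm _ _

/-- The increment of second order of the path around `T₁ + T k / n`, on the grid of step `T / n`,
multiplied by `c n ^ h`. The index is `(n, k)`. -/
noncomputable def scaledIncrement {Ω : Type*} (c h T₁ T : ℝ) (B : ℝ → Ω → ℝ) (p : ℕ × ℕ) (ω : Ω) : ℝ :=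
  c * (p.1 : ℝ) ^ h * secondDiff (fun t => B t ω) (T₁ + T * (p.2 / p.1)) (T / p.1)

lemma sum_sq_scaledIncrement {Ω : Type*} (c h T₁ T₂ : ℝ) (B : ℝ → Ω → ℝ) (n : ℕ) (ω : Ω) :
    ∑ k ∈ Finset.Ico 1 n, scaledIncrement c h T₁ (T₂ - T₁) B (n, k) ω ^ 2
      = c ^ 2 * ((n : ℝ) ^ h) ^ 2 * quadVar n (fun t => reindexedProcess T₁ T₂ B t ω) := by
  rw [quadVar, Finset.mul_sum]
  refine Finset.sum_congr rfl fun k _ => ?_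
  rw [scaledIncrement, mul_pow, mul_pow]
  simp only [secondDiff, reindexedProcess]
  rw [show T₁ + (T₂ - T₁) * (k / n) + (T₂ - T₁) / n = (T₂ - T₁) * ((k + 1) / n) + T₁ by ring,
    show T₁ + (T₂ - T₁) * (k / n) - (T₂ - T₁) / n = (T₂ - T₁) * ((k - 1) / n) + T₁ by ring,
    show T₁ + (T₂ - T₁) * (k / n) = (T₂ - T₁) * (k / n) + T₁ by ring]

variable {H K : ℝ} {B : ℝ → Ω → ℝ}

lemma IsTwoParamFBM.memLp_two (hB : IsTwoParamFBM P H K B) (t : ℝ) : MemLp (B t) 2 P :=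
  (hB.isGaussianProcess.hasGaussianLaw_eval t).memLp_two

lemma IsTwoParamFBM.isGaussianProcess_scaledIncrement (hB : IsTwoParamFBM P H K B)
    (c h T₁ T : ℝ) : IsGaussianProcess (scaledIncrement c h T₁ T B) P := by
  classical
  refine hB.isGaussianProcess.of_isGaussianProcess fun p => ?_
  set s := T₁ + T * (p.2 / p.1 : ℝ)
  set δ := T / (p.1 : ℝ)
  refine ⟨{s + δ, s - δ, s},
    (c * (p.1 : ℝ) ^ h) • (.proj ⟨s + δ, by simp⟩ + .proj ⟨s - δ, by simp⟩
      - (2 : ℝ) • .proj ⟨s, by simp⟩), fun ω => ?_⟩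
  simp [scaledIncrement, secondDiff, s, δ]

lemma IsTwoParamFBM.integral_scaledIncrement [IsFiniteMeasure P] (hB : IsTwoParamFBM P H K B)
    (c h T₁ T : ℝ) (p : ℕ × ℕ) : ∫ ω, scaledIncrement c h T₁ T B p ω ∂P = 0 := by
  have hi : ∀ t, Integrable (B t) P := fun t => (hB.memLp_two t).integrable (by norm_num)
  simp only [scaledIncrement, secondDiff]
  rw [integral_const_mul, integral_sub (f := fun ω => B _ ω + B _ ω) ((hi _).add (hi _))
    ((hi _).const_mul 2), integral_add (hi _) (hi _), integral_const_mul, hB.centered, hB.centered, hB.centered]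
  simp

/-- The covariances of the scaled increments are those of fractional Brownian motion with Hurst
parameter `H K`, up to the contribution of the smooth part of the covariance function. -/
lemma IsTwoParamFBM.exists_covariance_scaledIncrement [IsFiniteMeasure P] (hB : IsTwoParamFBM P H K B) (c h : ℝ)
    {T₁ T₂ : ℝ} (hT₁ : 0 < T₁) (hT : T₁ < T₂) :
    ∃ C, 0 ≤ C ∧ ∀ n m i j : ℕ, i ∈ Finset.Ico 1 n → j ∈ Finset.Ico 1 m →
      |cov[scaledIncrement c h T₁ (T₂ - T₁) B (n, i), scaledIncrement c h T₁ (T₂ - T₁) B (m, j); P]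
        + c ^ 2 * (n : ℝ) ^ h * (m : ℝ) ^ h * (1 / 2 ^ K)
          * secondDiff (fun x => secondDiff (fun y => |x - y| ^ (2 * (H * K)))
            (T₁ + (T₂ - T₁) * (j / m)) ((T₂ - T₁) / m)) (T₁ + (T₂ - T₁) * (i / n)) ((T₂ - T₁) / n)|
        ≤ C * ((n : ℝ) ^ h * (m : ℝ) ^ h / ((n : ℝ) ^ 2 * (m : ℝ) ^ 2)) := by
  obtain ⟨C, hC, hbd⟩ := exists_abs_secondDiff_secondDiff_le (2 * H) K (T₂ := T₂) hT₁
  set T := T₂ - T₁ with hTdef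
  have hTpos : 0 < T := by rw [hTdef]; linarith
  refine ⟨c ^ 2 * (1 / 2 ^ K) * (C * T ^ 2 * T ^ 2), by positivity, fun n m i j hi hj => ?_⟩
  have hgrid : ∀ {n i : ℕ}, i ∈ Finset.Ico 1 n → 0 ≤ T / (n : ℝ) ∧
      T₁ ≤ T₁ + T * (i / n) - T / n ∧ T₁ + T * (i / n) + T / n ≤ T₂ := by
    intro n i hi
    rw [Finset.mem_Ico] at hi
    have hn : (0 : ℝ) < n := by exact_mod_cast (show 0 < n by omega)
    have hi1 : (1 : ℝ) ≤ i := by exact_mod_cast hi.1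
    have hi2 : (i : ℝ) + 1 ≤ n := by exact_mod_cast hi.2
    refine ⟨by positivity, ?_, ?_⟩
    · have : 0 ≤ T * ((i - 1) / n) := mul_nonneg hTpos.le (div_nonneg (by linarith) hn.le)
      have e : T * ((i - 1) / n) = T * (i / n) - T / n := by ring
      linarith
    · have : T * ((i + 1) / n) ≤ T * 1 :=
        mul_le_mul_of_nonneg_left ((div_le_one hn).2 hi2) hTpos.le
      have e : T * ((i + 1 : ℝ) / n) = T * (i / n) + T / n := by ring
      linarith
  obtain ⟨hδ, hs1, hs2⟩ := hgrid hi
  obtain ⟨hε, ht1, ht2⟩ := hgrid hj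
  have hb := hbd _ _ _ _ hδ hs1 hs2 hε ht1 ht2
  set s := T₁ + T * (i / n : ℝ) with hs
  set t := T₁ + T * (j / m : ℝ) with ht
  set δ := T / (n : ℝ) with hδdef
  set ε := T / (m : ℝ) with hεdef
  have hcov : cov[scaledIncrement c h T₁ T B (n, i), scaledIncrement c h T₁ T B (m, j); P]
      = c ^ 2 * (n : ℝ) ^ h * (m : ℝ) ^ h
        * secondDiff (fun x => secondDiff (fun y => twoParamFBMCov H K x y) t ε) s δ := by
    have e1 : scaledIncrement c h T₁ T B (n, i)
        = fun ω => (c * (n : ℝ) ^ h) * secondDiff (fun t => B t ω) s δ := rfl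
    have e2 : scaledIncrement c h T₁ T B (m, j)
        = fun ω => (c * (m : ℝ) ^ h) * secondDiff (fun t => B t ω) t ε := rfl
    rw [e1, e2, covariance_const_mul_left, covariance_const_mul_right,
      covariance_secondDiff_secondDiff hB.memLp_two]
    simp only [hB.covariance_eq]
    ring
  -- All grid points lie in `[T₁, T₂]`, hence are positive, so the absolute values in the smooth
  -- kernel disappear.
  have hsplit : secondDiff (fun x => secondDiff (fun y => twoParamFBMCov H K x y) t ε) s δ
      = 1 / 2 ^ K * (secondDiff (fun x => secondDiff
          (fun y => (x ^ (2 * H) + y ^ (2 * H)) ^ K) t ε) s δ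
        - secondDiff (fun x => secondDiff (fun y => |x - y| ^ (2 * (H * K))) t ε) s δ) := by
    have : secondDiff (fun x => secondDiff (fun y => twoParamFBMCov H K x y) t ε) s δ
        = secondDiff (fun x => secondDiff (fun y => 1 / 2 ^ K * ((x ^ (2 * H) + y ^ (2 * H)) ^ K
          - |x - y| ^ (2 * (H * K)))) t ε) s δ := by
      refine secondDiff_congr hδ fun x hx => secondDiff_congr hε fun y hy => ?_
      rw [twoParamFBMCov, abs_of_nonneg (a := x) (by linarith [hx.1]),
        abs_of_nonneg (a := y) (by linarith [hy.1]), mul_assoc 2 H K]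
    rw [this]
    simp only [secondDiff]
    ring
  rw [hcov, hsplit]
  set A := secondDiff (fun x => secondDiff (fun y => (x ^ (2 * H) + y ^ (2 * H)) ^ K) t ε) s δ
  set E := secondDiff (fun x => secondDiff (fun y => |x - y| ^ (2 * (H * K))) t ε) s δ
  have hre : c ^ 2 * (n : ℝ) ^ h * (m : ℝ) ^ h * (1 / 2 ^ K * (A - E))
      + c ^ 2 * (n : ℝ) ^ h * (m : ℝ) ^ h * (1 / 2 ^ K) * E
      = (c ^ 2 * (n : ℝ) ^ h * (m : ℝ) ^ h * (1 / 2 ^ K)) * A := by ring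
  have hnn : 0 ≤ c ^ 2 * (n : ℝ) ^ h * (m : ℝ) ^ h * (1 / 2 ^ K) := by positivity
  rw [hre, abs_mul, abs_of_nonneg hnn]
  refine (mul_le_mul_of_nonneg_left hb hnn).trans_eq ?_
  rw [hδdef, hεdef]
  ring

variable {T₁ T₂ c : ℝ}

/-- The normalization of `c` and the factor `n^(2h)` cancel the scale of the fractional kernel
exactly. The smooth kernel leaves an error of order `n^(2h-4) ≤ n⁻²`. -/
lemma IsTwoParamFBM.exists_abs_covariance_sub_fbmCov_le [IsFiniteMeasure P] (hB : IsTwoParamFBM P H K B)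
    (hh1 : H * K < 1) (hT₁ : 0 < T₁) (hT : T₁ < T₂)
    (hc : c ^ 2 * (1 / 2 ^ K) * (T₂ - T₁) ^ (2 * (H * K)) = 1) :
    ∃ C, ∀ n, ∀ i ∈ Finset.Ico 1 n, ∀ j ∈ Finset.Ico 1 n,
      |cov[scaledIncrement c (H * K) T₁ (T₂ - T₁) B (n, i),
        scaledIncrement c (H * K) T₁ (T₂ - T₁) B (n, j); P] - fbmCov (H * K) ((i : ℤ) - j)|
        ≤ C / (n : ℝ) ^ 2 := by
  obtain ⟨C, hC, hbd⟩ := hB.exists_covariance_scaledIncrement c (H * K) hT₁ hT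
  refine ⟨C, fun n i hi j hj => ?_⟩
  have hb := hbd n n i j hi hj
  have hn1 : 1 ≤ n := by have := Finset.mem_Ico.1 hi; omega
  have hn : (1 : ℝ) ≤ n := by exact_mod_cast hn1
  have hn0 : (0 : ℝ) < n := by linarith
  have hTpos : 0 < T₂ - T₁ := by linarith
  rw [secondDiff_secondDiff_abs_sub_rpow (m := (i : ℤ) - j) (by positivity)
    (by push_cast; field_simp; ring)] at hb
  have hpow : (n : ℝ) ^ (H * K) * (n : ℝ) ^ (H * K) = (n : ℝ) ^ (2 * (H * K)) := by
    rw [← Real.rpow_add hn0]; ring_nf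
  have hone : c ^ 2 * (n : ℝ) ^ (H * K) * (n : ℝ) ^ (H * K) * (1 / 2 ^ K)
      * ((T₂ - T₁) / n) ^ (2 * (H * K)) = 1 := by
    rw [Real.div_rpow hTpos.le hn0.le, ← hpow]
    have : (n : ℝ) ^ (H * K) ≠ 0 := by positivity
    refine Eq.trans ?_ hc
    field_simp
  rw [mul_neg, ← mul_assoc, hone, one_mul, ← sub_eq_add_neg] at hb
  refine hb.trans ?_
  have hle : (n : ℝ) ^ (H * K) ≤ n := by
    simpa using Real.rpow_le_rpow_of_exponent_le hn hh1.le
  calc C * ((n : ℝ) ^ (H * K) * (n : ℝ) ^ (H * K) / ((n : ℝ) ^ 2 * (n : ℝ) ^ 2))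
      ≤ C * ((n : ℝ) * n / ((n : ℝ) ^ 2 * (n : ℝ) ^ 2)) := by gcongr
    _ = C / (n : ℝ) ^ 2 := by field_simp

/-- The common lattice has step `(T₂ - T₁) / (2n)`, while the scaling is `n^h (2n)^h`; the quotient
by `(2n)^(2h)` is the factor `2^(-h)`. -/
lemma IsTwoParamFBM.exists_abs_covariance_sub_fbmCrossCov_le [IsFiniteMeasure P] (hB : IsTwoParamFBM P H K B)
    (hh1 : H * K < 1) (hT₁ : 0 < T₁) (hT : T₁ < T₂)
    (hc : c ^ 2 * (1 / 2 ^ K) * (T₂ - T₁) ^ (2 * (H * K)) = 1) :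
    ∃ C, ∀ n, ∀ i ∈ Finset.Ico 1 n, ∀ j ∈ Finset.Ico 1 (2 * n),
      |cov[scaledIncrement c (H * K) T₁ (T₂ - T₁) B (n, i),
        scaledIncrement c (H * K) T₁ (T₂ - T₁) B (2 * n, j); P]
        - 2 ^ (-(H * K)) * fbmCrossCov (H * K) (((2 : ℕ) : ℤ) * i - j)| ≤ C / (n : ℝ) ^ 2 := by
  obtain ⟨C, hC, hbd⟩ := hB.exists_covariance_scaledIncrement c (H * K) hT₁ hT
  refine ⟨C, fun n i hi j hj => ?_⟩
  have hb := hbd n (2 * n) i j hi hj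
  have hn1 : 1 ≤ n := by have := Finset.mem_Ico.1 hi; omega
  have hn : (1 : ℝ) ≤ n := by exact_mod_cast hn1
  have hn0 : (0 : ℝ) < n := by linarith
  have hTpos : 0 < T₂ - T₁ := by linarith
  have hcast : ((2 * n : ℕ) : ℝ) = 2 * n := by push_cast; ring
  rw [hcast] at hb
  rw [show (T₂ - T₁) / (n : ℝ) = 2 * ((T₂ - T₁) / (2 * n)) by field_simp,
    secondDiff_secondDiff_abs_sub_rpow_two_mul (m := ((2 : ℕ) : ℤ) * i - j) (by positivity)
    (by push_cast; field_simp; ring)] at hb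
  have hpow : (2 * n : ℝ) ^ (H * K) * (2 * n : ℝ) ^ (H * K) = (2 * n : ℝ) ^ (2 * (H * K)) := by
    rw [← Real.rpow_add (by positivity)]; ring_nf
  have hone : c ^ 2 * (n : ℝ) ^ (H * K) * (2 * n : ℝ) ^ (H * K) * (1 / 2 ^ K)
      * ((T₂ - T₁) / (2 * n)) ^ (2 * (H * K)) = 2 ^ (-(H * K)) := by
    have h2 : (2 : ℝ) ^ (H * K) ≠ 0 := by positivity
    have h3 : (n : ℝ) ^ (H * K) ≠ 0 := by positivity
    rw [Real.div_rpow hTpos.le (by positivity), ← hpow, Real.mul_rpow (by norm_num) hn0.le,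
      Real.rpow_neg (by norm_num)]
    refine Eq.trans ?_ ((congrArg (((2 : ℝ) ^ (H * K))⁻¹ * ·) hc).trans (mul_one _))
    field_simp
  rw [mul_neg, ← mul_assoc, hone, ← sub_eq_add_neg] at hb
  refine hb.trans ?_
  have hle : (n : ℝ) ^ (H * K) ≤ n := by
    simpa using Real.rpow_le_rpow_of_exponent_le hn hh1.le
  have hle2 : (2 * n : ℝ) ^ (H * K) ≤ 2 * n := by
    simpa using Real.rpow_le_rpow_of_exponent_le (show (1 : ℝ) ≤ 2 * n by linarith) hh1.le
  calc C * ((n : ℝ) ^ (H * K) * (2 * n : ℝ) ^ (H * K) / ((n : ℝ) ^ 2 * (2 * n : ℝ) ^ 2))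
      ≤ C * ((n : ℝ) * (2 * n) / ((n : ℝ) ^ 2 * (2 * n : ℝ) ^ 2)) := by gcongr
    _ = C / (n : ℝ) ^ 2 / 2 := by field_simp
    _ ≤ C / (n : ℝ) ^ 2 := half_le_self (by positivity)

end Increments

/-! ### Linearization of the logarithm -/

section DeltaMethod

lemma abs_log_sub_sub_one_le {z : ℝ} (hz : |z - 1| ≤ 1 / 2) :
    |Real.log z - (z - 1)| ≤ 2 * (z - 1) ^ 2 := by
  have hx : |1 - z| ≤ 1 / 2 := by rwa [abs_sub_comm]
  have h := Real.abs_log_sub_add_sum_range_le (x := 1 - z) (by linarith) 1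
  simp only [Finset.sum_range_one, zero_add, pow_one, Nat.cast_zero, div_one, sub_sub_cancel] at h
  have h2 : |1 - z| ^ 2 / (1 - |1 - z|) ≤ 2 * (z - 1) ^ 2 := by
    rw [div_le_iff₀ (by linarith), sq_abs]
    nlinarith [sq_nonneg (z - 1), sq_nonneg (1 - z)]
  have e : Real.log z - (z - 1) = 1 - z + Real.log z := by ring
  rw [e]
  exact h.trans h2

lemma tendsto_one_of_sqrt_mul_sq {z : ℕ → ℝ}
    (hz : Tendsto (fun n : ℕ => √(n : ℝ) * (z n - 1) ^ 2) atTop (𝓝 0)) :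
    Tendsto z atTop (𝓝 1) := by
  have h1 : Tendsto (fun n => (z n - 1) ^ 2) atTop (𝓝 0) := by
    refine squeeze_zero' (Eventually.of_forall fun n => sq_nonneg _) ?_ hz
    filter_upwards [eventually_ge_atTop 1] with n hn
    have : 1 ≤ √(n : ℝ) := Real.one_le_sqrt.2 (by exact_mod_cast hn)
    nlinarith [sq_nonneg (z n - 1)]
  have h2 := (Real.continuous_sqrt.tendsto _).comp h1
  simp only [Real.sqrt_zero, Function.comp_def, Real.sqrt_sq_eq_abs] at h2
  simpa using ((tendsto_zero_iff_abs_tendsto_zero _).2 h2).add_const 1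

/-- The error of linearizing `log` at 1 is quadratic, so the rate `√n (z n - 1)² → 0` is enough;
boundedness of `√n (z n - 1)` is not required. -/
lemma tendsto_sqrt_mul_log_sub {z : ℕ → ℝ}
    (hz : Tendsto (fun n : ℕ => √(n : ℝ) * (z n - 1) ^ 2) atTop (𝓝 0)) :
    Tendsto (fun n : ℕ => √(n : ℝ) * (Real.log (z n) - (z n - 1))) atTop (𝓝 0) := by
  have h1 := tendsto_one_of_sqrt_mul_sq hz
  have h2 : Tendsto (fun n : ℕ => 2 * (√(n : ℝ) * (z n - 1) ^ 2)) atTop (𝓝 0) := by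
    simpa using hz.const_mul 2
  refine squeeze_zero_norm' ?_ h2
  have h3 : Tendsto (fun n => |z n - 1|) atTop (𝓝 0) := by
    simpa using (h1.sub_const 1).abs
  filter_upwards [h3.eventually_le_const (show (0 : ℝ) < 1 / 2 by norm_num)] with n hn
  rw [norm_mul, Real.norm_eq_abs, Real.norm_eq_abs, abs_of_nonneg (Real.sqrt_nonneg _)]
  nlinarith [abs_log_sub_sub_one_le hn, Real.sqrt_nonneg (n : ℝ)]

end DeltaMethod

/-! ### Quadratic variations on the grids of sizes n and 2n -/

section TwoGrids

variable {Ω : Type*} [MeasurableSpace Ω] {P : Measure Ω} [IsProbabilityMeasure P]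
  {H K : ℝ} {B : ℝ → Ω → ℝ} {T₁ T₂ c : ℝ}

lemma fbmCov_zero_pos {h : ℝ} (h0 : 0 < h) (h1 : h < 1) : 0 < fbmCov h 0 := by
  rw [fbmCov_zero h0]
  have : (2 : ℝ) ^ (2 * h) < 2 ^ (2 : ℝ) :=
    Real.rpow_lt_rpow_of_exponent_lt (by norm_num) (by linarith)
  norm_num at this
  linarith

/-- Row sums of the covariance matrices of the increments on the grids `n` and `2 n`. -/
lemma IsTwoParamFBM.exists_sum_abs_covariance_le (hB : IsTwoParamFBM P H K B)
    (hh1 : H * K < 1) (hT₁ : 0 < T₁) (hT : T₁ < T₂)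
    (hc : c ^ 2 * (1 / 2 ^ K) * (T₂ - T₁) ^ (2 * (H * K)) = 1) :
    ∃ M, 0 ≤ M ∧
      (∀ n, ∀ i ∈ Finset.Ico 1 n, ∑ j ∈ Finset.Ico 1 n,
        |cov[scaledIncrement c (H * K) T₁ (T₂ - T₁) B (n, i),
          scaledIncrement c (H * K) T₁ (T₂ - T₁) B (n, j); P]| ≤ M) ∧
      (∀ n, ∀ i ∈ Finset.Ico 1 n, ∑ j ∈ Finset.Ico 1 (2 * n),
        |cov[scaledIncrement c (H * K) T₁ (T₂ - T₁) B (n, i),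
          scaledIncrement c (H * K) T₁ (T₂ - T₁) B (2 * n, j); P]| ≤ M) ∧
      (∀ n, ∀ j ∈ Finset.Ico 1 (2 * n), ∑ i ∈ Finset.Ico 1 n,
        |cov[scaledIncrement c (H * K) T₁ (T₂ - T₁) B (2 * n, j),
          scaledIncrement c (H * K) T₁ (T₂ - T₁) B (n, i); P]| ≤ M) := by
  obtain ⟨C₁, hC₁⟩ := hB.exists_abs_covariance_sub_fbmCov_le hh1 hT₁ hT hc
  obtain ⟨C₂, hC₂⟩ := hB.exists_abs_covariance_sub_fbmCrossCov_le hh1 hT₁ hT hc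
  have hs₁ := summable_abs_fbmCov hh1
  have hs₂ : Summable fun m : ℤ => |2 ^ (-(H * K)) * fbmCrossCov (H * K) m| := by
    simp only [abs_mul]
    exact (summable_abs_fbmCrossCov hh1).mul_left _
  set A₁ := ∑' m : ℤ, |fbmCov (H * K) m|
  set A₂ := ∑' m : ℤ, |2 ^ (-(H * K)) * fbmCrossCov (H * K) m|
  have hA₁ : 0 ≤ A₁ := tsum_nonneg fun _ => abs_nonneg _
  have hA₂ : 0 ≤ A₂ := tsum_nonneg fun _ => abs_nonneg _
  refine ⟨A₁ + A₂ + |C₁| + 2 * |C₂|, by positivity, fun n i hi => ?_, fun n i hi => ?_,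
    fun n j hj => ?_⟩
  · have hn : 1 ≤ n := by have := Finset.mem_Ico.1 hi; omega
    have := sum_abs_le_of_abs_sub_le (a := 1) hs₁ hn (s := Finset.Ico 1 n) (by simp)
      (g := fun j => (i : ℤ) - j) (fun x y e => by simpa using e) (hC₁ n i hi)
    refine this.trans ?_
    push_cast
    linarith [abs_nonneg C₂]
  · have hn : 1 ≤ n := by have := Finset.mem_Ico.1 hi; omega
    have := sum_abs_le_of_abs_sub_le (a := 2) hs₂ hn (s := Finset.Ico 1 (2 * n)) (by simp)
      (g := fun j => ((2 : ℕ) : ℤ) * i - j) (fun x y e => by simpa using e) (hC₂ n i hi)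
    refine this.trans ?_
    push_cast
    linarith [abs_nonneg C₁]
  · have hn : 1 ≤ n := by have := Finset.mem_Ico.1 hj; omega
    have := sum_abs_le_of_abs_sub_le (a := 1) hs₂ hn (s := Finset.Ico 1 n) (by simp)
      (g := fun i => ((2 : ℕ) : ℤ) * i - j) (fun x y e => by simpa using e)
      (fun i hi => hC₂ n i hi j hj)
    simp only [covariance_comm _ (scaledIncrement c (H * K) T₁ (T₂ - T₁) B (n, _))]  at this ⊢
    refine this.trans ?_
    push_cast
    linarith [abs_nonneg C₁, abs_nonneg C₂]

lemma IsTwoParamFBM.tendsto_sum_covariance_sq (hB : IsTwoParamFBM P H K B) (hh0 : 0 < H * K)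
    (hh1 : H * K < 1) (hT₁ : 0 < T₁) (hT : T₁ < T₂)
    (hc : c ^ 2 * (1 / 2 ^ K) * (T₂ - T₁) ^ (2 * (H * K)) = 1) :
    Tendsto (fun n : ℕ => (n : ℝ)⁻¹ * ∑ i ∈ Finset.Ico 1 n, ∑ j ∈ Finset.Ico 1 n,
      cov[scaledIncrement c (H * K) T₁ (T₂ - T₁) B (n, i),
        scaledIncrement c (H * K) T₁ (T₂ - T₁) B (n, j); P] ^ 2) atTop
      (𝓝 (2 * sigmaSqFBM (H * K))) := by
  obtain ⟨C, hC⟩ := hB.exists_abs_covariance_sub_fbmCov_le hh1 hT₁ hT hc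
  rw [← tsum_fbmCov_sq hh0 hh1]
  have := tendsto_average_sq (summable_abs_fbmCov hh1) (le_refl 1) (C := C)
    (S := fun n i j => cov[scaledIncrement c (H * K) T₁ (T₂ - T₁) B (n, i),
        scaledIncrement c (H * K) T₁ (T₂ - T₁) B (n, j); P])
    (by simpa only [one_mul, Nat.cast_one] using hC)
  simpa only [one_mul] using this

lemma IsTwoParamFBM.tendsto_sum_cross_covariance_sq (hB : IsTwoParamFBM P H K B)
    (hh0 : 0 < H * K) (hh1 : H * K < 1) (hT₁ : 0 < T₁) (hT : T₁ < T₂)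
    (hc : c ^ 2 * (1 / 2 ^ K) * (T₂ - T₁) ^ (2 * (H * K)) = 1) :
    Tendsto (fun n : ℕ => (n : ℝ)⁻¹ * ∑ i ∈ Finset.Ico 1 n, ∑ j ∈ Finset.Ico 1 (2 * n),
      cov[scaledIncrement c (H * K) T₁ (T₂ - T₁) B (n, i),
        scaledIncrement c (H * K) T₁ (T₂ - T₁) B (2 * n, j); P] ^ 2) atTop
      (𝓝 ((2 : ℝ) ^ (2 - 2 * (H * K)) * sigmaSqStarFBM (H * K))) := by
  obtain ⟨C, hC⟩ := hB.exists_abs_covariance_sub_fbmCrossCov_le hh1 hT₁ hT hc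
  have hs : Summable fun m : ℤ => |2 ^ (-(H * K)) * fbmCrossCov (H * K) m| := by
    simp only [abs_mul]
    exact (summable_abs_fbmCrossCov hh1).mul_left _
  have e : (2 : ℝ) ^ (2 - 2 * (H * K)) * sigmaSqStarFBM (H * K)
      = ∑' m : ℤ, (2 ^ (-(H * K)) * fbmCrossCov (H * K) m) ^ 2 := by
    simp only [mul_pow]
    rw [tsum_mul_left, tsum_fbmCrossCov_sq hh0 hh1, ← Real.rpow_natCast, ← Real.rpow_mul (by norm_num),
      show (2 : ℝ) - 2 * (H * K) = -(H * K) * (2 : ℕ) + 2 by push_cast; ring,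
      Real.rpow_add (by norm_num)]
    norm_num
    ring
  rw [e]
  exact tendsto_average_sq hs one_le_two hC

/-- The normalized quadratic variation. -/
noncomputable def normalizedQuadVar {Ω : Type*} (c h T₁ T : ℝ) (B : ℝ → Ω → ℝ) (n : ℕ) (ω : Ω) : ℝ :=
  (fbmCov h 0 * n)⁻¹ * ∑ k ∈ Finset.Ico 1 n, scaledIncrement c h T₁ T B (n, k) ω ^ 2

/-- The expectation of the normalized quadratic variation. -/
noncomputable def normalizedQuadVarMean (P : Measure Ω) (c h T₁ T : ℝ) (B : ℝ → Ω → ℝ) (n : ℕ) : ℝ :=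
  (fbmCov h 0 * n)⁻¹ * ∑ k ∈ Finset.Ico 1 n,
    cov[scaledIncrement c h T₁ T B (n, k), scaledIncrement c h T₁ T B (n, k); P]

/-- Each variance is `fbmCov (H * K) 0` up to order `n⁻²`. The dominant bias `-1 / n` comes from
dividing a sum of `n - 1` terms by `n`. -/
lemma IsTwoParamFBM.exists_abs_normalizedQuadVarMean_sub_one_le (hB : IsTwoParamFBM P H K B)
    (hh0 : 0 < H * K) (hh1 : H * K < 1) (hT₁ : 0 < T₁) (hT : T₁ < T₂)
    (hc : c ^ 2 * (1 / 2 ^ K) * (T₂ - T₁) ^ (2 * (H * K)) = 1) :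
    ∃ C, 0 ≤ C ∧ ∀ n : ℕ, 1 ≤ n →
      |normalizedQuadVarMean P c (H * K) T₁ (T₂ - T₁) B n - 1| ≤ C / n := by
  obtain ⟨C, hC⟩ := hB.exists_abs_covariance_sub_fbmCov_le hh1 hT₁ hT hc
  have hr := fbmCov_zero_pos hh0 hh1
  set r := fbmCov (H * K) 0 with hrdef
  refine ⟨|C| / r + 1, by positivity, fun n hn => ?_⟩
  have hn' : (1 : ℝ) ≤ n := by exact_mod_cast hn
  have hn0 : (0 : ℝ) < n := by linarith
  set v : ℕ → ℝ := fun k => cov[scaledIncrement c (H * K) T₁ (T₂ - T₁) B (n, k),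
    scaledIncrement c (H * K) T₁ (T₂ - T₁) B (n, k); P] with hv
  have e : normalizedQuadVarMean P c (H * K) T₁ (T₂ - T₁) B n - 1
      = (r * n)⁻¹ * ∑ k ∈ Finset.Ico 1 n, (v k - r) - 1 / n := by
    have e0 : normalizedQuadVarMean P c (H * K) T₁ (T₂ - T₁) B n
        = (r * n)⁻¹ * ∑ k ∈ Finset.Ico 1 n, v k := rfl
    rw [e0, Finset.sum_sub_distrib, Finset.sum_const, Nat.card_Ico, nsmul_eq_mul, Nat.cast_sub hn]
    field_simp
    push_cast
    ring
  rw [e]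
  have h1 : |∑ k ∈ Finset.Ico 1 n, (v k - r)| ≤ n * (|C| / (n : ℝ) ^ 2) := by
    refine (Finset.abs_sum_le_sum_abs _ _).trans ((Finset.sum_le_sum fun k hk =>
      (?_ : |v k - r| ≤ |C| / (n : ℝ) ^ 2)).trans ?_)
    · have := hC n k hk k hk
      rw [sub_self] at this
      refine this.trans ?_
      gcongr
      exact le_abs_self C
    · rw [Finset.sum_const, Nat.card_Ico, nsmul_eq_mul]
      have c1 : ((n - 1 : ℕ) : ℝ) ≤ n := by exact_mod_cast Nat.sub_le _ _
      gcongr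
  calc |(r * n)⁻¹ * ∑ k ∈ Finset.Ico 1 n, (v k - r) - 1 / n|
      ≤ |(r * n)⁻¹ * ∑ k ∈ Finset.Ico 1 n, (v k - r)| + |1 / (n : ℝ)| := abs_sub _ _
    _ ≤ (r * n)⁻¹ * (n * (|C| / (n : ℝ) ^ 2)) + 1 / n := by
        rw [abs_mul, abs_of_pos (by positivity : 0 < (r * n)⁻¹),
          abs_of_pos (by positivity : 0 < 1 / (n : ℝ))]
        gcongr
    _ = |C| / r / n / n + 1 / n := by field_simp
    _ ≤ |C| / r / n + 1 / n := add_le_add (div_le_self (by positivity) hn') le_rfl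
    _ = (|C| / r + 1) / n := by ring

lemma tendsto_sqrt_mul_of_abs_le_div {u : ℕ → ℝ} {C : ℝ} (hu : ∀ n : ℕ, 1 ≤ n → |u n| ≤ C / n) :
    Tendsto (fun n : ℕ => √(n : ℝ) * u n) atTop (𝓝 0) := by
  have hlim : Tendsto (fun n : ℕ => C / √(n : ℝ)) atTop (𝓝 0) :=
    (Real.tendsto_sqrt_atTop.comp tendsto_natCast_atTop_atTop).const_div_atTop C
  refine squeeze_zero_norm' ?_ hlim
  filter_upwards [eventually_ge_atTop 1] with n hn
  have hn0 : (0 : ℝ) < n := by exact_mod_cast hn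
  have hs : 0 < √(n : ℝ) := Real.sqrt_pos.2 hn0
  rw [norm_mul, Real.norm_eq_abs, Real.norm_eq_abs, abs_of_pos hs]
  refine (mul_le_mul_of_nonneg_left (hu n hn) hs.le).trans_eq ?_
  rw [mul_div_assoc', div_eq_div_iff hn0.ne' hs.ne', mul_right_comm, Real.mul_self_sqrt hn0.le]
  ring

lemma IsTwoParamFBM.ae_tendsto_sqrt_mul_normalizedQuadVar_sub_one (hB : IsTwoParamFBM P H K B)
    (hh0 : 0 < H * K) (hh1 : H * K < 1) (hT₁ : 0 < T₁) (hT : T₁ < T₂)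
    (hc : c ^ 2 * (1 / 2 ^ K) * (T₂ - T₁) ^ (2 * (H * K)) = 1) :
    ∀ᵐ ω ∂P, Tendsto (fun n : ℕ => √(n : ℝ)
      * (normalizedQuadVar c (H * K) T₁ (T₂ - T₁) B n ω - 1) ^ 2) atTop (𝓝 0) := by
  obtain ⟨M, hM0, hM, -, -⟩ := hB.exists_sum_abs_covariance_le hh1 hT₁ hT hc
  obtain ⟨C, hC0, hC⟩ := hB.exists_abs_normalizedQuadVarMean_sub_one_le hh0 hh1 hT₁ hT hc
  have hr := fbmCov_zero_pos hh0 hh1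
  have hlim := hB.tendsto_sum_covariance_sq hh0 hh1 hT₁ hT hc
  set r := fbmCov (H * K) 0 with hrdef
  set ξ := scaledIncrement c (H * K) T₁ (T₂ - T₁) B with hξ
  have hG := hB.isGaussianProcess_scaledIncrement c (H * K) T₁ (T₂ - T₁)
  rw [← hξ] at hG
  set V := 2 * sigmaSqFBM (H * K) with hV
  have key := ae_tendsto_sqrt_mul_gaussian_sum_sq (P := P)
    (ι := fun n => ↥(Finset.Ico 1 n)) (X := fun n k => ξ (n, k))
    (fun n => (hG.comp_right (fun k => (n, k))).hasGaussianLaw (Finset.Ico 1 n))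
    (fun n k => hB.integral_scaledIncrement _ _ _ _ _)
    -- The first summand of `C` bounds the weighted row sums, the second the weighted sum of squared
    -- covariances.
    (fun n _ => (r * n)⁻¹) (C := M / r + (|V| + 1) / r ^ 2) ?_ ?_
  · filter_upwards [key] with ω hω
    have h1 : Tendsto (fun n : ℕ => √(n : ℝ) * (normalizedQuadVar c (H * K) T₁ (T₂ - T₁) B n ω
        - normalizedQuadVarMean P c (H * K) T₁ (T₂ - T₁) B n) ^ 2) atTop (𝓝 0) := by
      refine hω.congr fun n => ?_
      rw [normalizedQuadVar, normalizedQuadVarMean, ← mul_sub, ← Finset.sum_sub_distrib,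
        ← Finset.mul_sum,
        Finset.sum_coe_sort (Finset.Ico 1 n) (fun k => ξ (n, k) ω ^ 2 - cov[ξ (n, k), ξ (n, k); P])]
    have h2 : Tendsto (fun n : ℕ => √(n : ℝ)
        * (normalizedQuadVarMean P c (H * K) T₁ (T₂ - T₁) B n - 1) ^ 2) atTop (𝓝 0) := by
      refine tendsto_sqrt_mul_of_abs_le_div (C := C ^ 2) fun n hn => ?_
      have hn' : (1 : ℝ) ≤ n := by exact_mod_cast hn
      rw [abs_of_nonneg (sq_nonneg _), ← sq_abs]
      calc _ ≤ (C / n) ^ 2 := by gcongr; exact hC n hn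
        _ = C ^ 2 / n / n := by field_simp
        _ ≤ C ^ 2 / n := div_le_self (by positivity) hn'
    have h3 := (h1.const_mul 2).add (h2.const_mul 2)
    simp only [mul_zero, add_zero] at h3
    refine squeeze_zero (fun n => by positivity) (fun n => ?_) h3
    have hs := Real.sqrt_nonneg (n : ℝ)
    set x := normalizedQuadVar c (H * K) T₁ (T₂ - T₁) B n ω
    set y := normalizedQuadVarMean P c (H * K) T₁ (T₂ - T₁) B n
    have : (x - 1) ^ 2 ≤ 2 * (x - y) ^ 2 + 2 * (y - 1) ^ 2 := by
      nlinarith [sq_nonneg ((x - y) - (y - 1))]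
    nlinarith
  · filter_upwards [eventually_ge_atTop 1,
      hlim.eventually_le_const (show V < |V| + 1 by linarith [le_abs_self V])] with n hn hlt
    have hn0 : (0 : ℝ) < n := by exact_mod_cast hn
    have e : ∑ i : ↥(Finset.Ico 1 n), ∑ j : ↥(Finset.Ico 1 n),
        (r * n)⁻¹ * (r * n)⁻¹ * cov[ξ (n, i), ξ (n, j); P] ^ 2
        = (r * n)⁻¹ * (r * n)⁻¹ * ∑ i ∈ Finset.Ico 1 n, ∑ j ∈ Finset.Ico 1 n,
          cov[ξ (n, i), ξ (n, j); P] ^ 2 := by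
      simp_rw [← Finset.mul_sum]
      congr 1
      rw [← Finset.sum_coe_sort (Finset.Ico 1 n)]
      refine Finset.sum_congr rfl fun i _ => ?_
      exact Finset.sum_coe_sort (Finset.Ico 1 n) (fun j => cov[ξ (n, i), ξ (n, j); P] ^ 2)
    rw [e]
    calc _ = (r ^ 2 * n)⁻¹ * ((n : ℝ)⁻¹ * ∑ i ∈ Finset.Ico 1 n, ∑ j ∈ Finset.Ico 1 n,
          cov[ξ (n, i), ξ (n, j); P] ^ 2) := by field_simp
      _ ≤ (r ^ 2 * n)⁻¹ * (|V| + 1) := by gcongr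
      _ = (|V| + 1) / r ^ 2 / n := by field_simp
      _ ≤ _ := by gcongr; linarith [div_nonneg hM0 hr.le]
  · filter_upwards [eventually_ge_atTop 1] with n hn i
    have hn0 : (0 : ℝ) < n := by exact_mod_cast hn
    have hrn : 0 < (r * n)⁻¹ := by positivity
    simp only [abs_of_pos hrn]
    rw [← Finset.sum_mul, Finset.sum_coe_sort (Finset.Ico 1 n) (fun j => |cov[ξ (n, i), ξ (n, j); P]|)]
    calc _ ≤ M * (r * n)⁻¹ := by gcongr; exact hM n i i.2
      _ = M / r / n := by field_simp
      _ ≤ _ := by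
        gcongr
        have : 0 ≤ (|V| + 1) / r ^ 2 := by positivity
        linarith

end TwoGrids

/-! ### Joint central limit theorem and reduction of the estimator -/

section Estimator

variable {Ω : Type*} [MeasurableSpace Ω] {P : Measure Ω} [IsProbabilityMeasure P]
  {H K : ℝ} {B : ℝ → Ω → ℝ} {T₁ T₂ c : ℝ}

lemma sum_coe_disjSum {α β : Type*} (s : Finset α) (t : Finset β) (f : α ⊕ β → ℝ) :
    ∑ p : ↥(s.disjSum t), f p = ∑ i ∈ s, f (Sum.inl i) + ∑ j ∈ t, f (Sum.inr j) := by
  rw [Finset.sum_coe_sort _ f, Finset.sum_disjSum]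

/-- Central limit theorem for the difference of the normalized quadratic variations on the grids
`n` and `2 n`. -/
lemma IsTwoParamFBM.tendstoInDistribution_normalizedQuadVar_sub (hB : IsTwoParamFBM P H K B)
    (hh0 : 0 < H * K) (hh1 : H * K < 1) (hT₁ : 0 < T₁) (hT : T₁ < T₂)
    (hc : c ^ 2 * (1 / 2 ^ K) * (T₂ - T₁) ^ (2 * (H * K)) = 1) :
    0 ≤ hkAsymptoticVariance (H * K) ∧
    TendstoInDistribution (fun (n : ℕ) ω => √(n : ℝ) * ((2 * Real.log 2)⁻¹ *
      ((normalizedQuadVar c (H * K) T₁ (T₂ - T₁) B n ω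
          - normalizedQuadVarMean P c (H * K) T₁ (T₂ - T₁) B n)
        - (normalizedQuadVar c (H * K) T₁ (T₂ - T₁) B (2 * n) ω
          - normalizedQuadVarMean P c (H * K) T₁ (T₂ - T₁) B (2 * n)))))
      atTop (id : ℝ → ℝ) (fun _ => P)
      (gaussianReal 0 (hkAsymptoticVariance (H * K)).toNNReal) := by
  obtain ⟨M, hM0, hM₁, hM₂, hM₃⟩ := hB.exists_sum_abs_covariance_le hh1 hT₁ hT hc
  have hr := fbmCov_zero_pos hh0 hh1
  have hlim₁ := hB.tendsto_sum_covariance_sq hh0 hh1 hT₁ hT hc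
  have hlim₂ := hB.tendsto_sum_cross_covariance_sq hh0 hh1 hT₁ hT hc
  have hlim₃ := hlim₁.comp (tendsto_id.const_mul_atTop' (show 0 < 2 by norm_num))
  have hr4 := fbmCov_zero hh0
  set r := fbmCov (H * K) 0 with hrdef
  set ξ := scaledIncrement c (H * K) T₁ (T₂ - T₁) B with hξ
  have hG := hB.isGaussianProcess_scaledIncrement c (H * K) T₁ (T₂ - T₁)
  rw [← hξ] at hG
  set L := (2 * Real.log 2)⁻¹ with hL
  have hlog : 0 < Real.log 2 := Real.log_pos one_lt_two
  have hL0 : 0 < L := by positivity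
  -- The increments of both grids are treated as a single Gaussian vector; opposite signs in `D`
  -- encode the difference, so no joint limit theorem is needed.
  let idx : ℕ → ℕ ⊕ ℕ → ℕ × ℕ := fun n => Sum.elim (fun k => (n, k)) (fun k => (2 * n, k))
  let s : ℕ → Finset (ℕ ⊕ ℕ) := fun n => (Finset.Ico 1 n).disjSum (Finset.Ico 1 (2 * n))
  let D : ℕ → ℕ ⊕ ℕ → ℝ := fun n =>
    Sum.elim (fun _ => √(n : ℝ) * (L * (r * n)⁻¹)) (fun _ => -(√(n : ℝ) * (L * (r * (2 * n))⁻¹)))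
  have hX : ∀ n, HasGaussianLaw (fun ω (i : ↥(s n)) => ξ (idx n i) ω) P :=
    fun n => (hG.comp_right (idx n)).hasGaussianLaw (s n)
  have h0 : ∀ n (i : ↥(s n)), ∫ ω, ξ (idx n i) ω ∂P = 0 :=
    fun n i => hB.integral_scaledIncrement _ _ _ _ _
  have hvar : Tendsto (fun n => ∑ i : ↥(s n), ∑ j : ↥(s n),
      D n i * D n j * cov[ξ (idx n i), ξ (idx n j); P] ^ 2) atTop
      (𝓝 (hkAsymptoticVariance (H * K) / 2)) := by
    -- The three terms come from the coarse block, the two cross blocks and the fine block, whose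
    -- weights are half as large but whose averages run over `2n` rows. The target is half the
    -- variance because `g² - 1` has variance 2.
    have hv : hkAsymptoticVariance (H * K) / 2
        = L ^ 2 / r ^ 2 * (2 * sigmaSqFBM (H * K))
          - L ^ 2 / r ^ 2 * ((2 : ℝ) ^ (2 - 2 * (H * K)) * sigmaSqStarFBM (H * K))
          + L ^ 2 / (2 * r ^ 2) * (2 * sigmaSqFBM (H * K)) := by
      have h4 : (4 : ℝ) - 2 ^ (2 * (H * K)) ≠ 0 := by
        intro h; rw [h, mul_zero] at hr4; exact hr.ne' hr4
      rw [hkAsymptoticVariance, hL, hr4]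
      field_simp
      ring
    rw [hv]
    refine (((hlim₁.const_mul (L ^ 2 / r ^ 2)).sub (hlim₂.const_mul (L ^ 2 / r ^ 2))).add
      (hlim₃.const_mul (L ^ 2 / (2 * r ^ 2)))).congr' ?_
    filter_upwards [eventually_ge_atTop 1] with n hn
    have hn0 : (0 : ℝ) < n := by exact_mod_cast hn
    have hsq : √(n : ℝ) ^ 2 = n := Real.sq_sqrt hn0.le
    have inner : ∀ i, ∑ j : ↥(s n), D n i * D n j * cov[ξ (idx n i), ξ (idx n j); P] ^ 2
        = _ := fun i => sum_coe_disjSum _ _ fun j =>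
          D n i * D n j * cov[ξ (idx n i), ξ (idx n j); P] ^ 2
    simp only [inner]
    rw [sum_coe_disjSum _ _ fun i =>
      ∑ j ∈ Finset.Ico 1 n, D n i * D n (.inl j) * cov[ξ (idx n i), ξ (idx n (.inl j)); P] ^ 2
      + ∑ j ∈ Finset.Ico 1 (2 * n), D n i * D n (.inr j)
        * cov[ξ (idx n i), ξ (idx n (.inr j)); P] ^ 2]
    simp only [D, idx, Sum.elim_inl, Sum.elim_inr, Finset.sum_add_distrib, ← Finset.mul_sum,
      Function.comp_def, id]
    have hcomm : ∑ i ∈ Finset.Ico 1 (2 * n), ∑ j ∈ Finset.Ico 1 n,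
        cov[ξ (2 * n, i), ξ (n, j); P] ^ 2
        = ∑ i ∈ Finset.Ico 1 n, ∑ j ∈ Finset.Ico 1 (2 * n), cov[ξ (n, i), ξ (2 * n, j); P] ^ 2 := by
      rw [Finset.sum_comm]
      exact Finset.sum_congr rfl fun i _ => Finset.sum_congr rfl fun j _ => by
        rw [covariance_comm]
    rw [hcomm]
    set A := ∑ i ∈ Finset.Ico 1 n, ∑ j ∈ Finset.Ico 1 n, cov[ξ (n, i), ξ (n, j); P] ^ 2
    set E := ∑ i ∈ Finset.Ico 1 n, ∑ j ∈ Finset.Ico 1 (2 * n), cov[ξ (n, i), ξ (2 * n, j); P] ^ 2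
    set F := ∑ i ∈ Finset.Ico 1 (2 * n), ∑ j ∈ Finset.Ico 1 (2 * n),
      cov[ξ (2 * n, i), ξ (2 * n, j); P] ^ 2
    push_cast
    field_simp
    rw [hsq]
    ring
  have hnonneg : 0 ≤ hkAsymptoticVariance (H * K) := by
    classical
    -- The variance formula is not visibly nonnegative; it is so as a limit of sums of squares `∑
    -- μⱼ²`.
    have : 0 ≤ hkAsymptoticVariance (H * K) / 2 := by
      refine ge_of_tendsto' hvar fun n => ?_
      obtain ⟨μ, -, hsq, -⟩ := exists_map_sum_sq_eq (hX n) (h0 n) (fun i => D n i)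
      rw [← hsq]
      positivity
    linarith
  refine ⟨hnonneg, ?_⟩
  have hm : Tendsto (fun n : ℕ => √(n : ℝ) * (2 * M * L / r / n)) atTop (𝓝 0) :=
    tendsto_sqrt_mul_of_abs_le_div (C := 2 * M * L / r) fun n _ =>
      (abs_of_nonneg (by positivity)).le
  have key := tendstoInDistribution_gaussian_sum_sq hX h0 (fun n i => D n i) hnonneg hvar hm ?_
  · refine key.congr (fun n => ?_) EventuallyEq.rfl
    refine EventuallyEq.of_eq (funext fun ω => ?_)
    rw [sum_coe_disjSum _ _ fun i => D n i * (ξ (idx n i) ω ^ 2 - cov[ξ (idx n i), ξ (idx n i); P])]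
    simp only [D, idx, Sum.elim_inl, Sum.elim_inr, ← Finset.mul_sum, Finset.sum_sub_distrib]
    simp only [normalizedQuadVar, normalizedQuadVarMean, ← hξ, ← hrdef]
    push_cast
    ring
  · filter_upwards [eventually_ge_atTop 1] with n hn i
    have hn0 : (0 : ℝ) < n := by exact_mod_cast hn
    have habs : ∀ j, |D n j| ≤ √(n : ℝ) * (L / r / n) := by
      rintro (j | j)
      · simp only [D, Sum.elim_inl]
        rw [abs_of_nonneg (by positivity)]
        exact le_of_eq (by field_simp)
      · simp only [D, Sum.elim_inr]
        rw [abs_neg, abs_of_nonneg (by positivity)]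
        gcongr
        rw [← div_eq_mul_inv, div_div]
        gcongr
        linarith
    have hrow : ∑ j : ↥(s n), |cov[ξ (idx n i), ξ (idx n j); P]| ≤ 2 * M := by
      rw [sum_coe_disjSum _ _ fun j => |cov[ξ (idx n i), ξ (idx n j); P]|, two_mul M]
      obtain ⟨i | i, hi⟩ := i
      · rw [Finset.inl_mem_disjSum] at hi
        exact add_le_add (hM₁ n i hi) (hM₂ n i hi)
      · rw [Finset.inr_mem_disjSum] at hi
        exact add_le_add (hM₃ n i hi) (hM₁ (2 * n) i hi)
    calc ∑ j : ↥(s n), |cov[ξ (idx n i), ξ (idx n j); P]| * |D n j|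
        ≤ ∑ j : ↥(s n), |cov[ξ (idx n i), ξ (idx n j); P]| * (√(n : ℝ) * (L / r / n)) := by
          gcongr with j
          exact habs j
      _ = (∑ j : ↥(s n), |cov[ξ (idx n i), ξ (idx n j); P]|) * (√(n : ℝ) * (L / r / n)) := by
          rw [Finset.sum_mul]
      _ ≤ 2 * M * (√(n : ℝ) * (L / r / n)) := by gcongr
      _ = √(n : ℝ) * (2 * M * L / r / n) := by ring

/-- Undoing the normalization multiplies the ratio of quadratic variations by `2^(1-2h)`, whose
logarithm over `2 log 2` is `1/2 - h`. Positivity excludes zero quadratic variations, where division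
and `log` take default values. -/
lemma hkEstimator_sub_eq {Ω : Type*} {B : ℝ → Ω → ℝ} {h c T₁ T₂ : ℝ} {n : ℕ} {ω : Ω} (hn : 1 ≤ n)
    (h1 : 0 < normalizedQuadVar c h T₁ (T₂ - T₁) B n ω)
    (h2 : 0 < normalizedQuadVar c h T₁ (T₂ - T₁) B (2 * n) ω) :
    hkEstimator n (fun t => reindexedProcess T₁ T₂ B t ω) - h
      = (2 * Real.log 2)⁻¹ * (Real.log (normalizedQuadVar c h T₁ (T₂ - T₁) B n ω)
        - Real.log (normalizedQuadVar c h T₁ (T₂ - T₁) B (2 * n) ω)) := by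
  have hn0 : (0 : ℝ) < n := by exact_mod_cast hn
  have hlog : 0 < Real.log 2 := Real.log_pos one_lt_two
  have e1 : normalizedQuadVar c h T₁ (T₂ - T₁) B n ω = _ :=
    congrArg ((fbmCov h 0 * n)⁻¹ * ·) (sum_sq_scaledIncrement c h T₁ T₂ B n ω)
  have e2 : normalizedQuadVar c h T₁ (T₂ - T₁) B (2 * n) ω = _ :=
    congrArg ((fbmCov h 0 * (2 * n : ℕ))⁻¹ * ·) (sum_sq_scaledIncrement c h T₁ T₂ B (2 * n) ω)
  set V := quadVar n (fun t => reindexedProcess T₁ T₂ B t ω)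
  set W := quadVar (2 * n) (fun t => reindexedProcess T₁ T₂ B t ω)
  set z := normalizedQuadVar c h T₁ (T₂ - T₁) B n ω
  set w := normalizedQuadVar c h T₁ (T₂ - T₁) B (2 * n) ω
  have hr : fbmCov h 0 ≠ 0 := by
    intro hr; rw [hr] at e1; simp at e1; exact h1.ne' e1
  have hc : c ≠ 0 := by
    intro hc; rw [hc] at e1; simp at e1; exact h1.ne' e1
  have hV : V ≠ 0 := by
    intro hV; rw [hV] at e1; simp at e1; exact h1.ne' e1
  have hp : 0 < (n : ℝ) ^ h := by positivity
  have hq : 0 < (2 : ℝ) ^ h := by positivity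
  have hratio : W / V = w / z * (2 / ((2 : ℝ) ^ h) ^ 2) := by
    rw [e1, e2]
    push_cast
    rw [Real.mul_rpow (by norm_num) hn0.le]
    field_simp
  change 1 / 2 - Real.log (W / V) / (2 * Real.log 2) - h = _
  rw [hratio, Real.log_mul (by positivity) (by positivity), Real.log_div h2.ne' h1.ne',
    Real.log_div (by norm_num) (by positivity), Real.log_pow, Real.log_rpow (by norm_num)]
  field_simp
  push_cast
  ring

end Estimator

/-! ### Consistency and asymptotic normality -/

theorem proposition6 {Ω : Type*} [MeasurableSpace Ω] (P : Measure Ω) [IsProbabilityMeasure P]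
    (H K : ℝ) (hH : 0 < H) (hH1 : H < 1) (hK : 0 < K) (hK1 : K < 1)
    (T₁ T₂ : ℝ) (hT₁ : 0 < T₁) (hT : T₁ < T₂)
    (B : ℝ → Ω → ℝ) (hB : IsTwoParamFBM P H K B) :
    -- strong consistency
    (∀ᵐ ω ∂P, Tendsto (fun n : ℕ => hkEstimator n (fun t => reindexedProcess T₁ T₂ B t ω))
      atTop (𝓝 (H * K))) ∧
    -- asymptotic normality (the variance of the limit law is a nonnegative number)
    0 ≤ hkAsymptoticVariance (H * K) ∧
    TendstoInDistribution
      (fun (n : ℕ) ω =>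
        √(n : ℝ) * (hkEstimator n (fun t => reindexedProcess T₁ T₂ B t ω) - H * K))
      atTop (id : ℝ → ℝ) (fun _ => P)
      (gaussianReal 0 (hkAsymptoticVariance (H * K)).toNNReal) := by
  have hh0 : 0 < H * K := by positivity
  have hh1 : H * K < 1 := by nlinarith
  have hTpos : 0 < T₂ - T₁ := by linarith
  -- This `c` gives the fractional part of the increments the covariance `fbmCov (H * K)`; it
  -- cancels in the ratio defining the estimator.
  set c : ℝ := (√(1 / 2 ^ K * (T₂ - T₁) ^ (2 * (H * K))))⁻¹ with hcdef
  have hc : c ^ 2 * (1 / 2 ^ K) * (T₂ - T₁) ^ (2 * (H * K)) = 1 := by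
    rw [hcdef, inv_pow, Real.sq_sqrt (by positivity), mul_assoc, inv_mul_cancel₀ (by positivity)]
  obtain ⟨hnonneg, hclt⟩ :=
    hB.tendstoInDistribution_normalizedQuadVar_sub hh0 hh1 hT₁ hT hc
  have hae := hB.ae_tendsto_sqrt_mul_normalizedQuadVar_sub_one hh0 hh1 hT₁ hT hc
  obtain ⟨C, hC0, hC⟩ := hB.exists_abs_normalizedQuadVarMean_sub_one_le hh0 hh1 hT₁ hT hc
  set Z := normalizedQuadVar c (H * K) T₁ (T₂ - T₁) B with hZ
  set EZ := normalizedQuadVarMean P c (H * K) T₁ (T₂ - T₁) B with hEZ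
  set L := (2 * Real.log 2)⁻¹ with hL
  have h2n : Tendsto (fun n : ℕ => 2 * n) atTop atTop :=
    tendsto_id.const_mul_atTop' (show 0 < 2 by norm_num)
  have hest : ∀ ω, Tendsto (fun n => Z n ω) atTop (𝓝 1) → ∀ᶠ n : ℕ in atTop,
      hkEstimator n (fun t => reindexedProcess T₁ T₂ B t ω) - H * K
        = L * (Real.log (Z n ω) - Real.log (Z (2 * n) ω)) := by
    intro ω hω
    filter_upwards [eventually_ge_atTop 1, hω.eventually_const_lt one_pos,
      (hω.comp h2n).eventually_const_lt one_pos] with n hn hn1 hn2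
    exact hkEstimator_sub_eq hn hn1 hn2
  have hmean : Tendsto (fun n : ℕ => √(n : ℝ) * (EZ n - EZ (2 * n))) atTop (𝓝 0) := by
    refine tendsto_sqrt_mul_of_abs_le_div (C := 2 * C) fun n hn => ?_
    have hn0 : (0 : ℝ) < n := by exact_mod_cast hn
    calc |EZ n - EZ (2 * n)| = |(EZ n - 1) - (EZ (2 * n) - 1)| := by ring_nf
      _ ≤ |EZ n - 1| + |EZ (2 * n) - 1| := abs_sub _ _
      _ ≤ C / n + C / (2 * n : ℕ) := add_le_add (hC n hn) (hC (2 * n) (by omega))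
      _ ≤ C / n + C / n := by
        gcongr
        omega
      _ = 2 * C / n := by ring
  -- The remainder consists of the two linearization errors and the difference of the means, which
  -- is of order `1 / n`.
  have hrem : ∀ᵐ ω ∂P, Tendsto (fun n : ℕ =>
      √(n : ℝ) * (hkEstimator n (fun t => reindexedProcess T₁ T₂ B t ω) - H * K)
        - √(n : ℝ) * (L * ((Z n ω - EZ n) - (Z (2 * n) ω - EZ (2 * n))))) atTop (𝓝 0) := by
    filter_upwards [hae] with ω hω
    have hlog := tendsto_sqrt_mul_log_sub hω
    have hlog2 : Tendsto (fun n : ℕ => √(n : ℝ) * (Real.log (Z (2 * n) ω) - (Z (2 * n) ω - 1)))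
        atTop (𝓝 0) := by
      -- The rate along the subsequence `2n` is `√(2n)`, hence the factor `1 / √2`.
      have h := ((hlog.comp h2n).const_mul (√2)⁻¹)
      rw [mul_zero] at h
      refine h.congr fun n => ?_
      have h2 : (√2 : ℝ) ≠ 0 := by positivity
      simp only [Function.comp_def, Nat.cast_mul, Nat.cast_ofNat]
      rw [Real.sqrt_mul (by norm_num)]
      field_simp
    have hsum := (((hlog.sub hlog2).add hmean).const_mul L)
    simp only [sub_zero, add_zero, mul_zero] at hsum
    refine hsum.congr' ?_
    filter_upwards [hest ω (tendsto_one_of_sqrt_mul_sq hω)] with n hn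
    rw [hn]
    ring
  have hmeas : ∀ n : ℕ, AEMeasurable
      (fun ω => hkEstimator n (fun t => reindexedProcess T₁ T₂ B t ω)) P := by
    intro n
    have := fun t => hB.isGaussianProcess.aemeasurable t
    unfold hkEstimator quadVar reindexedProcess
    fun_prop
  refine ⟨?_, hnonneg, ?_⟩
  · filter_upwards [hae] with ω hω
    have h1 := tendsto_one_of_sqrt_mul_sq hω
    have hl := h1.log one_ne_zero
    have h2 := (((hl.sub (hl.comp h2n)).const_mul L).add_const (H * K))
    simp only [sub_self, mul_zero, zero_add] at h2
    refine h2.congr' ?_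
    filter_upwards [hest ω h1] with n hn
    simp only [Function.comp_def]
    linarith
  -- Slutsky's lemma: a remainder tending to zero in probability does not change the limit law.
  · have hrm : TendstoInMeasure P (fun (n : ℕ) ω =>
        √(n : ℝ) * (hkEstimator n (fun t => reindexedProcess T₁ T₂ B t ω) - H * K)
        - √(n : ℝ) * (L * ((Z n ω - EZ n) - (Z (2 * n) ω - EZ (2 * n))))) atTop
        (fun _ => (0 : ℝ)) := by
      refine tendstoInMeasure_of_tendsto_ae (fun n => ?_) hrem
      exact ((((hmeas n).sub_const _).const_mul _).sub
        (hclt.forall_aemeasurable n)).aestronglyMeasurable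
    have := hclt.add_of_tendstoInMeasure_const hrm
      (fun n => (((hmeas n).sub_const _).const_mul _).sub (hclt.forall_aemeasurable n))
    refine this.congr (fun n => EventuallyEq.of_eq (funext fun ω => ?_))
      (EventuallyEq.of_eq (funext fun ω => add_zero _))
    simp
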